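/- An \emph{abstract polytope} of rank $n\ge 0$ is a poset $\mathcal P$ with a least element $0_{\mathcal P}$ and a greatest element $1_{\mathcal P}$ in which (i) every maximal chain has exactly $n+2$ elements, so that there is a rank function with $\mathrm{rank}(0_{\mathcal P})=-1$ and $\mathrm{rank}(1_{\mathcal P})=n$; (ii) for all $F\le G$, either $\mathrm{rank}(G)-\mathrm{rank}(F)\le 2$, or any two elements strictly between $F$ and $G$ are joined by a sequence of successively comparable elements strictly between $F$ and $G$; (iii) whenever $F\le G$ and $\mathrm{rank}(G)-\mathrm{rank}(F)=2$, exactly two elements lie strictly between $F$ and $G$. Vertices are the elements of rank $0$; $pt$ and $I$ are the polytopes of rank $0$ and $1$; $\mathrm{Aut}(\mathcal P)$ is the group of order automorphisms. The join is $\mathcal P*\mathcal Q=\{(F,G): F\in\mathcal P,\,G\in\mathcal Q\}$ and the Cartesian product is $\mathcal P\times\mathcal Q=\{(F,G): \mathrm{rank}(F),\mathrm{rank}(G)\ge 0\}\cup\{(0_{\mathcal P},0_{\mathcal Q})\}$, both with the componentwise order; $\mathcal P^{*k}$ and $\mathcal P^{\times k}$ are the $k$-fold products. A \emph{pyramid}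 is a polytope isomorphic to $\mathcal R*pt$, and a \emph{prism} is a polytope isomorphic to $\mathcal R\times I$, for some abstract polytope $\mathcal R$. Let $\mathcal C$ be the family of polytopes obtained from $I$ by finitely many steps $\mathcal P\mapsto\mathcal P\times I$ and $\mathcal P\mapsto\mathcal P*pt$. Put $B_k=(\mathbb Z/2)^k\rtimes \mathrm{Sym}(k)$, where $\mathrm{Sym}(k)$ permutes the coordinates. \textbf{0. The family.} A member of $\mathcal C$ constructed in $s$ steps is an abstract polytope of rank $s+1$. If the last step of the construction of $\mathcal P\in\mathcal C$ was $\times I$, then $\mathcal P\cong I^{\times k}$ for some $k\ge1$, or $\mathcal P\cong \mathcal Q\times I^{\times k}$ for some $k\ge1$ and some pyramid $\mathcal Q\in\mathcal C$ of rank at least $2$. If the last step was $*\,pt$, then $\mathcal P\cong pt^{*k}$ for some $k\ge1$, or $\mathcal P\cong\mathcal Q*pt^{*k}$ for some $k\ge 1$ and some prism $\mathcal Q\in\mathcal C$ of rank at least $2$. \textbf{1. Automorphism groups.} Let $k\ge1$. (a) If $\mathcal P\cong I^{\times k}$, then $\mathrm{Aut}(\mathcal P)\cong B_k$. (b) If $\mathcal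 P\cong\mathcal Q\times I^{\times k}$ for an abstract polytope $\mathcal Q$ of rank at least $2$ that is a pyramid, then $\mathrm{Aut}(\mathcal P)\cong\mathrm{Aut}(\mathcal Q)\times B_k$. (c) If $\mathcal P\cong pt^{*k}$, then $\mathrm{Aut}(\mathcal P)\cong \mathrm{Sym}(k)$. (d) If $\mathcal P\cong\mathcal Q*pt^{*k}$ for an abstract polytope $\mathcal Q$ of rank at least $2$ that is a prism, then $\mathrm{Aut}(\mathcal P)\cong\mathrm{Aut}(\mathcal Q)\times \mathrm{Sym}(k)$. \textbf{2. Algorithm.} Attach to each $\mathcal P\in\mathcal C$ (with its construction) data $(A(\mathcal P),k(\mathcal P),\mathrm{prod}(\mathcal P))$ recursively, with the convention $null\times G=G$. Start with $I\mapsto(null,1,cartesian)$ and $I*pt\mapsto(null,3,join)$. All other members are treated as follows, where $A=A(\mathcal P)$ and $k=k(\mathcal P)$. If $\mathrm{prod}(\mathcal P)=cartesian$, then $\mathcal P\times I\mapsto(A,k+1,cartesian)$ and $\mathcal P*pt\mapsto(A\times B_k,1,join)$. If $\mathrm{prod}(\mathcal P)=join$, then $\mathcal P\times I\mapsto(A\times\mathrm{Sym}(k),1,cartesian)$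 and $\mathcal P*pt\mapsto(A,k+1,join)$. Then for every $\mathcal P\in\mathcal C$, $\mathrm{Aut}(\mathcal P)\cong A(\mathcal P)\times B_{k(\mathcal P)}$ if $\mathrm{prod}(\mathcal P)=cartesian$, and $\mathrm{Aut}(\mathcal P)\cong A(\mathcal P)\times\mathrm{Sym}(k(\mathcal P))$ if $\mathrm{prod}(\mathcal P)=join$. Moreover, $A(\mathcal P)$ is isomorphic to the automorphism group of the last polytope in the construction of $\mathcal P$ that was obtained by the product other than that of the last step (for $I$, the cubes $(\cdots(I\times I)\times\cdots)\times I$ and the simplices $(\cdots(I*pt)*\cdots)*pt$ there is none, and $A=null$). \textbf{3. Generators.} Let $k\ge1$. The vertices of $I^{\times k}$ are identified with the vectors in $(\mathbb Z/2)^k$, and $\mathrm{Aut}(I^{\times k})$ is generated by automorphisms $\sigma,s_1,\dots,s_{k-1}$ acting on vertices by $\sigma(z_1,\dots,z_k)=(z_1+1,z_2,\dots,z_k)$ and $s_i(z)=(z_{\tau_i(1)},\dots,z_{\tau_i(k)})$, where $\tau_i=(i\;i+1)$. The vertices of $pt^{*k}$ are identified with $1,\dots,k$, and $\mathrm{Aut}(pt^{*k})$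 is generated by automorphisms acting on vertices as $\tau_1,\dots,\tau_{k-1}$. Now let $\mathcal R\in\mathcal C$, and let $S$ be a generating set of $\mathrm{Aut}(\mathcal P)$, where $\mathcal P$ is as below. Regard $S$ as a set of automorphisms of $\mathcal P\times I$ and of $\mathcal P*pt$ via $f\mapsto f\times\mathrm{id}$ and $f\mapsto f*\mathrm{id}$. (a) If $\mathcal P=\mathcal R\times I$, then $\mathrm{Aut}(\mathcal P\times I)$ is generated by $S$ together with the automorphism of $(\mathcal R\times I)\times I$ swapping the last two factors $I$, and $\mathrm{Aut}(\mathcal P*pt)$ is generated by $S$. (b) If $\mathcal P=\mathcal R*pt$, then $\mathrm{Aut}(\mathcal P\times I)$ is generated by $S$ together with any one automorphism that swaps the two copies of $\mathcal P$ in $\mathcal P\times I$ (such as the product of $\mathrm{id}_{\mathcal P}$ and the flip of $I$), and $\mathrm{Aut}(\mathcal P*pt)$ is generated by $S$ together with the automorphism of $(\mathcal R*pt)*pt$ swapping the last two copies of $pt$. -/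

import Mathlib

universe u

namespace InductivePolytopes

/-! ## Abstract polytopes -/

/-- The rank of an element of a poset: one less than the largest length of a chain
`x₀ < ⋯ < xₗ = x`. In an abstract polytope the least element has rank `-1`. -/
noncomputable def rank {P : Type*} [PartialOrder P] (x : P) : ℤ :=
  ((Order.height x).toNat : ℤ) - 1

/-- A vertex is an element of rank `0`. -/
def IsVertex {P : Type*} [PartialOrder P] (x : P) : Prop := rank x = 0

/-- The section `G / F` is connected: either `rank G - rank F ≤ 2`, or any two elements strictly
between `F` and `G` are joined by a sequence of successively incident elements strictly
between `F` and `G`. -/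
def SectionConnected {P : Type*} [PartialOrder P] (F G : P) : Prop :=
  rank G - rank F ≤ 2 ∨
    ∀ F' ∈ Set.Ioo F G, ∀ G' ∈ Set.Ioo F G,
      Relation.ReflTransGen
        (fun H H' : P => H ∈ Set.Ioo F G ∧ H' ∈ Set.Ioo F G ∧ (H ≤ H' ∨ H' ≤ H)) F' G'

/-- `P` is an abstract polytope of rank `n`. -/
structure IsPolytope (n : ℕ) (P : Type*) [PartialOrder P] : Prop where
  exists_bot : ∃ x : P, IsBot x
  exists_top : ∃ x : P, IsTop x
  /-- Every maximal chain has exactly `n + 2` elements. -/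
  flag_card : ∀ s : Flag P, (s : Set P).encard = n + 2
  connected : ∀ F G : P, F ≤ G → SectionConnected F G
  /-- The diamond condition. -/
  diamond : ∀ F G : P, F ≤ G → rank G - rank F = 2 → (Set.Ioo F G).encard = 2

/-- The group of automorphisms of a poset (composition as multiplication). -/
abbrev Aut (P : Type*) [PartialOrder P] : Type _ := P ≃o P

/-- The polytope of rank `0`: a chain with two elements. -/
abbrev Pt : Type := Bool

/-- The edge, the polytope of rank `1`: all faces `∅`, `{0}`, `{1}`, `{0, 1}` of a segment with
vertices `0` and `1`, ordered by inclusion. -/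
abbrev Edge : Type := Finset (ZMod 2)

/-! ## Joins and Cartesian products -/

/-- The join: all pairs, with the componentwise order. -/
abbrev Join (P Q : Type*) : Type _ := P × Q

/-- The Cartesian product: all pairs of elements of rank at least `0` (that is, different from
the least element), together with the pair of the two least elements; componentwise order. -/
def CartProd (P Q : Type*) [PartialOrder P] [PartialOrder Q] : Type _ :=
  {p : P × Q // (¬ IsBot p.1 ∧ ¬ IsBot p.2) ∨ (IsBot p.1 ∧ IsBot p.2)}

instance (P Q : Type*) [PartialOrder P] [PartialOrder Q] : PartialOrder (CartProd P Q) :=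
  inferInstanceAs (PartialOrder (Subtype _))

/-- The `k`-fold join of `P` with itself (used for `k ≥ 1`), as a poset of `k`-tuples. -/
abbrev JoinPow (P : Type*) (k : ℕ) : Type _ := Fin k → P

/-- The `k`-fold Cartesian product of `P` with itself (used for `k ≥ 1`), as a poset of
`k`-tuples: either all entries have rank at least `0`, or all entries are the least element. -/
def CartPow (P : Type*) [PartialOrder P] (k : ℕ) : Type _ :=
  {f : Fin k → P // (∀ i, ¬ IsBot (f i)) ∨ (∀ i, IsBot (f i))}

instance (P : Type*) [PartialOrder P] (k : ℕ) : PartialOrder (CartPow P k) :=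
  inferInstanceAs (PartialOrder (Subtype _))

/-- `P` is a pyramid: it has the form `R * pt` for an abstract polytope `R`. -/
def IsPyramid (P : Type u) [PartialOrder P] : Prop :=
  ∃ (R : Type u) (_ : PartialOrder R) (n : ℕ),
    IsPolytope n R ∧ Nonempty (P ≃o Join R Pt)

/-- `P` is a prism: it has the form `R × I` for an abstract polytope `R`. -/
def IsPrism (P : Type u) [PartialOrder P] : Prop :=
  ∃ (R : Type u) (_ : PartialOrder R) (n : ℕ),
    IsPolytope n R ∧ Nonempty (P ≃o CartProd R Edge)

section Maps

variable {P P' Q Q' : Type*} [PartialOrder P] [PartialOrder P'] [PartialOrder Q]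
  [PartialOrder Q']

theorem isBot_orderIso_iff (e : P ≃o P') (x : P) : IsBot (e x) ↔ IsBot x := by
  constructor
  · intro h y
    exact e.le_iff_le.1 (h (e y))
  · intro h y
    have := e.monotone (h (e.symm y))
    simpa using this

theorem CartProd.isBot_fst_iff (x : CartProd P Q) : IsBot x.1.1 ↔ IsBot x := by
  constructor
  · intro h y
    have h2 : IsBot x.1.2 := by
      rcases x.2 with hx | hx
      · exact absurd h hx.1
      · exact hx.2
    exact ⟨h _, h2 _⟩
  · intro h
    by_contra hp
    have hx : ¬ IsBot x.1.1 ∧ ¬ IsBot x.1.2 := by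
      rcases x.2 with hx | hx
      · exact hx
      · exact absurd hx.1 hp
    obtain ⟨p, hp'⟩ := not_forall.1 hx.1
    obtain ⟨q, hq'⟩ := not_forall.1 hx.2
    by_cases hpb : IsBot p
    · by_cases hqb : IsBot q
      · exact hp' (h ⟨(p, q), Or.inr ⟨hpb, hqb⟩⟩).1
      · exact hq' (h ⟨(x.1.1, q), Or.inl ⟨hx.1, hqb⟩⟩).2
    · exact hp' (h ⟨(p, x.1.2), Or.inl ⟨hpb, hx.2⟩⟩).1

/-- The product of two isomorphisms, on Cartesian products. -/
def CartProd.congr (e : P ≃o P') (f : Q ≃o Q') : CartProd P Q ≃o CartProd P' Q' where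
  toFun x := ⟨(e x.1.1, f x.1.2), by
    simpa only [isBot_orderIso_iff] using x.2⟩
  invFun x := ⟨(e.symm x.1.1, f.symm x.1.2), by
    simpa only [isBot_orderIso_iff] using x.2⟩
  left_inv x := Subtype.ext (by simp)
  right_inv x := Subtype.ext (by simp)
  map_rel_iff' {x y} := and_congr e.le_iff_le f.le_iff_le

theorem CartProd.swap_mem (x : CartProd (CartProd P Q) Q) :
    (¬ IsBot x.1.1.1.1 ∧ ¬ IsBot x.1.2) ∨ (IsBot x.1.1.1.1 ∧ IsBot x.1.2) := by
  rw [CartProd.isBot_fst_iff]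
  exact x.2

/-- The map `((p, a), b) ↦ ((p, b), a)` of `(P × Q) × Q`. -/
def CartProd.swapFun (x : CartProd (CartProd P Q) Q) : CartProd (CartProd P Q) Q :=
  ⟨((⟨(x.1.1.1.1, x.1.2), CartProd.swap_mem x⟩ : CartProd P Q), x.1.1.1.2), by
    rw [← CartProd.isBot_fst_iff]
    exact x.1.1.2⟩

/-- The automorphism `((p, a), b) ↦ ((p, b), a)` of `(P × Q) × Q`. -/
def CartProd.swapLast : Aut (CartProd (CartProd P Q) Q) where
  toFun := CartProd.swapFun
  invFun := CartProd.swapFun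
  left_inv _ := rfl
  right_inv _ := rfl
  map_rel_iff' {x y} := by
    change (x.1.1.1.1 ≤ y.1.1.1.1 ∧ x.1.2 ≤ y.1.2) ∧ x.1.1.1.2 ≤ y.1.1.1.2 ↔
      (x.1.1.1.1 ≤ y.1.1.1.1 ∧ x.1.1.1.2 ≤ y.1.1.1.2) ∧ x.1.2 ≤ y.1.2
    tauto

/-- The product of two isomorphisms, on joins. -/
def Join.congr (e : P ≃o P') (f : Q ≃o Q') : Join P Q ≃o Join P' Q' where
  toEquiv := e.toEquiv.prodCongr f.toEquiv
  map_rel_iff' {_ _} := and_congr e.le_iff_le f.le_iff_le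

/-- The automorphism `((p, a), b) ↦ ((p, b), a)` of `(P * Q) * Q`. -/
def Join.swapLast : Aut (Join (Join P Q) Q) where
  toFun x := ((x.1.1, x.2), x.1.2)
  invFun x := ((x.1.1, x.2), x.1.2)
  left_inv _ := rfl
  right_inv _ := rfl
  map_rel_iff' {x y} := by
    change (x.1.1 ≤ y.1.1 ∧ x.2 ≤ y.2) ∧ x.1.2 ≤ y.1.2 ↔
      (x.1.1 ≤ y.1.1 ∧ x.1.2 ≤ y.1.2) ∧ x.2 ≤ y.2
    tauto

/-! The powers are the iterated binary products. -/

/-- `P^{×1} = P`. -/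
def CartPow.one : CartPow P 1 ≃o P where
  toFun f := f.1 0
  invFun p := ⟨fun _ => p, by by_cases h : IsBot p <;> simp [h]⟩
  left_inv f := Subtype.ext (funext fun i => by rw [Subsingleton.elim i 0])
  right_inv _ := rfl
  map_rel_iff' {f g} := by
    constructor
    · intro h i
      rw [Subsingleton.elim i 0]
      exact h
    · intro h
      exact h 0

theorem CartPow.isBot_iff {k : ℕ} (f : CartPow P (k + 1)) : IsBot f ↔ IsBot (f.1 0) := by
  constructor
  · intro h
    by_contra h0
    have hf : ∀ i, ¬ IsBot (f.1 i) := by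
      rcases f.2 with hf | hf
      · exact hf
      · exact absurd (hf 0) h0
    obtain ⟨p, hp⟩ := not_forall.1 h0
    by_cases hb : IsBot p
    · exact hp (h ⟨fun _ => p, Or.inr fun _ => hb⟩ 0)
    · have := h ⟨Function.update f.1 0 p, Or.inl fun i => by
        by_cases hi : i = 0
        · subst hi; simpa using hb
        · simpa [hi] using hf i⟩ 0
      exact hp (by simpa using this)
  · intro h0 g i
    rcases f.2 with hf | hf
    · exact absurd h0 (hf 0)
    · exact hf i _

/-- `P^{×(k+2)} = P^{×(k+1)} × P`. -/
def CartPow.succ (k : ℕ) : CartPow P (k + 2) ≃o CartProd (CartPow P (k + 1)) P where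
  toFun f := ⟨(⟨fun i => f.1 i.castSucc, f.2.imp (fun h i => h _) (fun h i => h _)⟩,
    f.1 (Fin.last _)), by
      rw [CartPow.isBot_iff]
      exact f.2.imp (fun h => ⟨h _, h _⟩) (fun h => ⟨h _, h _⟩)⟩
  invFun x := ⟨Fin.snoc (α := fun _ => P) x.1.1.1 x.1.2, by
    have h := x.2
    rw [CartPow.isBot_iff] at h
    rcases x.1.1.2 with h1 | h1
    · left
      have h2 : ¬ IsBot x.1.2 := h.elim (fun h => h.2) (fun h => absurd h.1 (h1 0))
      intro i
      refine Fin.lastCases ?_ (fun i => ?_) i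
      · simpa using h2
      · simpa using h1 i
    · right
      have h2 : IsBot x.1.2 := h.elim (fun h => absurd (h1 0) h.1) (fun h => h.2)
      intro i
      refine Fin.lastCases ?_ (fun i => ?_) i
      · simpa using h2
      · simpa using h1 i⟩
  left_inv f := Subtype.ext (funext fun i => by
    refine Fin.lastCases ?_ (fun i => ?_) i <;> simp)
  right_inv x := Subtype.ext (Prod.ext (Subtype.ext (funext fun i => by simp)) (by simp))
  map_rel_iff' {f g} := by
    constructor
    · rintro ⟨h1, h2⟩ i
      refine Fin.lastCases ?_ (fun i => ?_) i
      · exact h2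
      · exact h1 i
    · intro h
      exact ⟨fun i => h _, h _⟩

end Maps

/-! ## The inductively constructed polytopes -/

/-- The construction process: start with an edge; from every polytope construct its Cartesian
product with an edge and its join with a point. -/
inductive Construction : Type
  | edge : Construction
  | timesEdge : Construction → Construction
  | joinPt : Construction → Construction

namespace Construction

/-- The polytope constructed. -/
def poly : Construction → PartOrd.{0}
  | edge => PartOrd.of Edge
  | timesEdge w => PartOrd.of (CartProd w.poly Edge)
  | joinPt w => PartOrd.of (Join w.poly Pt)

/-- The rank of the polytope constructed: each step raises it by one. -/
def dim : Construction → ℕ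
  | edge => 1
  | timesEdge w => w.dim + 1
  | joinPt w => w.dim + 1

/-- The last polytope in the construction that was obtained by the product other than the one
of the last step. An edge and its iterated joins with points (the simplices) have none, and
neither have the cubes. -/
def lastOther : Construction → Option Construction
  | edge => none
  | timesEdge edge => none
  | timesEdge (timesEdge w) => lastOther (timesEdge w)
  | timesEdge (joinPt w) => some (joinPt w)
  | joinPt edge => none
  | joinPt (timesEdge w) => some (timesEdge w)
  | joinPt (joinPt w) => lastOther (joinPt w)

end Construction

/-! ## The groups and the algorithm -/

/-- `(ℤ/2)^k ⋊ Sym(k)`, with `Sym(k)` permuting the coordinates. -/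
abbrev SignedPerm (k : ℕ) : Type :=
  (Fin k → Multiplicative (ZMod 2)) ⋊[mulAutArrow] Equiv.Perm (Fin k)

/-- Expressions for groups: `Sym(k)`, `(ℤ/2)^k ⋊ Sym(k)`, and direct products. -/
inductive GroupExpr : Type
  | sym : ℕ → GroupExpr
  | signedPerm : ℕ → GroupExpr
  | prod : GroupExpr → GroupExpr → GroupExpr

/-- The group denoted by an expression. -/
def GroupExpr.toGroup : GroupExpr → GrpCat.{0}
  | sym k => GrpCat.of (Equiv.Perm (Fin k))
  | signedPerm k => GrpCat.of (SignedPerm k)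
  | prod G H => GrpCat.of (G.toGroup × H.toGroup)

/-- The two products. -/
inductive ProductKind : Type
  | cartesian : ProductKind
  | join : ProductKind

/-- The data attached to a polytope: a group (or null), an integer, and a product. -/
structure Datum : Type where
  A : Option GroupExpr
  k : ℕ
  kind : ProductKind

/-- The product of a stored group with a further factor, where `null × G = G`. -/
def timesStored : Option GroupExpr → GroupExpr → GroupExpr
  | none, G => G
  | some H, G => GroupExpr.prod H G

/-- The data of `P × I`, computed from the data of `P`. -/
def Datum.timesEdge (d : Datum) : Datum :=
  match d.kind with
  | ProductKind.cartesian => ⟨d.A, d.k + 1, ProductKind.cartesian⟩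
  | ProductKind.join => ⟨some (timesStored d.A (GroupExpr.sym d.k)), 1, ProductKind.cartesian⟩

/-- The data of `P * pt`, computed from the data of `P`. -/
def Datum.joinPt (d : Datum) : Datum :=
  match d.kind with
  | ProductKind.cartesian =>
      ⟨some (timesStored d.A (GroupExpr.signedPerm d.k)), 1, ProductKind.join⟩
  | ProductKind.join => ⟨d.A, d.k + 1, ProductKind.join⟩

/-- The data that the algorithm attaches to each polytope. -/
def Construction.data : Construction → Datum
  | edge => ⟨none, 1, ProductKind.cartesian⟩
  | joinPt edge => ⟨none, 3, ProductKind.join⟩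
  | timesEdge w => w.data.timesEdge
  | joinPt w => w.data.joinPt

/-- The group that the algorithm reads off from the data. -/
def Datum.result (d : Datum) : GroupExpr :=
  match d.kind with
  | ProductKind.cartesian => timesStored d.A (GroupExpr.signedPerm d.k)
  | ProductKind.join => timesStored d.A (GroupExpr.sym d.k)

/-! ## Vertices and special automorphisms -/

/-- The vertex of the cube `I^{×k}` with coordinates `z`. -/
def cubeVertex {k : ℕ} (z : Fin k → ZMod 2) : CartPow Edge k :=
  ⟨fun i => {z i}, Or.inl fun i h => by
    have := h ∅
    simp at this⟩

/-- The vertex of the simplex `pt^{*k}` that belongs to the `i`-th copy of `pt`. -/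
def simplexVertex {k : ℕ} (i : Fin k) : JoinPow Pt k := fun j => decide (j = i)

/-- The nontrivial automorphism of the edge, swapping its two vertices. -/
def edgeFlip : Aut Edge where
  toEquiv := (Equiv.addRight (1 : ZMod 2)).finsetCongr
  map_rel_iff' {s t} := by
    simp [Equiv.finsetCongr_apply]

/-- An automorphism of `P × I` that swaps the two copies `P × {0}` and `P × {1}` of `P`. -/
def SwapsCopies {P : Type*} [PartialOrder P] (τ : Aut (CartProd P Edge)) : Prop :=
  ∀ (x : CartProd P Edge) (z : ZMod 2), x.1.2 = {z} → (τ x).1.2 = {z + 1}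

end InductivePolytopes

open InductivePolytopes

/-! The factors of a product are recognised by two invariants, one for each kind of product, both
preserved by every order automorphism.

For Cartesian products the invariant is the set of pairs of opposite facets, that is, facets with
only the least face below both. A facet of `P × Q` is a facet of one factor times the whole of the
other, and facets from different factors always meet; so an opposite pair of `P × Q` comes from an
opposite pair of `P` or of `Q` (`CartProd.opposite_cases`). The cube `I^{×k}` has one such pair for
each coordinate. A pyramid over a polytope of positive rank has none, because the base meets every
other facet and all other facets contain the apex (`not_opposite_join_pt`). An automorphism of `Q ×
I^{×k}`, with `Q` such a pyramid, therefore permutes the `k` pairs of the cube, which defines a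
signed permutation. Dividing by it leaves an automorphism that fixes each facet coming from the
cube, hence preserves the cube coordinate, hence acts on `Q` alone (`CartProd.exists_eq_congr_act`).

For joins the invariant is the set of apices, the vertices joined by an edge to every other vertex.
A vertex of `P * Q` is a vertex of one factor; every vertex of the simplex is an apex of `P *
pt^{*k}`, and an apex lying in `P` is already an apex of `P`. A prism over a polytope of positive
rank has none (`not_isApex_cartProd_edge`), so automorphisms of `Q * pt^{*k}`, with `Q` such a
prism, permute the `k` vertices of the simplex (`Join.exists_eq_congr_act`).

The structure theorem and the algorithm follow by one induction along the construction
(`Construction.decomposition`). That the objects are polytopes is checked with an explicit rank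
function, a property that survives both steps (`IsGraded`).

For the generators, an automorphism of `P × I` sends the two copies of `P` to opposite facets. If
these are again the copies, it is a product of automorphisms. Otherwise they come from an opposite
pair of `P`. This cannot happen for a pyramid; for a prism `P = R × I` all ordered opposite pairs
are equivalent under `Aut P` (`Construction.exists_aut_of_opposite`), so an element of `Aut P`
followed by the swap of the last two factors brings the copies back. Joins are treated in the same
way, with apices instead of opposite pairs. -/

namespace InductivePolytopes

/-! ## Connectedness of sets of faces -/

section Connected

variable {P P' : Type*} [PartialOrder P] [PartialOrder P']

/-- Comparability inside a set of faces. -/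
def Incident (s : Set P) (x y : P) : Prop := x ∈ s ∧ y ∈ s ∧ (x ≤ y ∨ y ≤ x)

/-- Any two elements of `s` are joined by a sequence of successively comparable elements of `s`. -/
def ConnectedIn (s : Set P) : Prop :=
  ∀ x ∈ s, ∀ y ∈ s, Relation.ReflTransGen (Incident s) x y

instance Incident.stdSymm (s : Set P) : Std.Symm (Incident s) :=
  ⟨fun _ _ h => ⟨h.2.1, h.1, h.2.2.symm⟩⟩

theorem Incident.of_le {s : Set P} {x y : P} (hx : x ∈ s) (hy : y ∈ s) (h : x ≤ y) :
    Relation.ReflTransGen (Incident s) x y :=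
  .single ⟨hx, hy, Or.inl h⟩

theorem Incident.of_ge {s : Set P} {x y : P} (hx : x ∈ s) (hy : y ∈ s) (h : y ≤ x) :
    Relation.ReflTransGen (Incident s) x y :=
  .single ⟨hx, hy, Or.inr h⟩

/-- Incidence is symmetric, so a path to the hub can be followed by a reversed one. Serves the
intervals in which both coordinates vary. -/
theorem ConnectedIn.of_hub {s : Set P} (c : P)
    (h : ∀ x ∈ s, Relation.ReflTransGen (Incident s) x c) : ConnectedIn s := fun x hx y hy =>
  (h x hx).trans
    (Relation.ReflTransGen.stdSymm.symm _ _ (h y hy))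

theorem ConnectedIn.image {s : Set P} (hs : ConnectedIn s) (φ : P → P') {t : Set P'}
    (hφ : ∀ x ∈ s, ∀ y ∈ s, x ≤ y → φ x ≤ φ y) (hst : ∀ y ∈ t, ∃ x ∈ s, φ x = y)
    (hts : ∀ x ∈ s, φ x ∈ t) :
    ConnectedIn t := by
  intro x hx y hy
  obtain ⟨x, hx', rfl⟩ := hst x hx
  obtain ⟨y, hy', rfl⟩ := hst y hy
  refine Relation.ReflTransGen.lift φ (fun a b h => ?_) _ _ (hs x hx' y hy')
  exact ⟨hts a h.1, hts b h.2.1, h.2.2.imp (hφ a h.1 b h.2.1) (hφ b h.2.1 a h.1)⟩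

end Connected

/-! ## Polytopes with a rank function -/

/-- `P` is an abstract polytope of rank `n`, in which the rank of `x` is `r x - 1`. -/
structure IsGraded (n : ℕ) (P : Type*) [PartialOrder P] (r : P → ℕ) : Prop where
  exists_bot : ∃ x : P, IsBot x ∧ r x = 0
  exists_top : ∃ x : P, IsTop x ∧ r x = n + 1
  strictMono : StrictMono r
  nonempty_Ioo : ∀ F G : P, F < G → r F + 1 < r G → (Set.Ioo F G).Nonempty
  connected : ∀ F G : P, F < G → r F + 2 < r G → ConnectedIn (Set.Ioo F G)
  diamond : ∀ F G : P, F < G → r F + 2 = r G → (Set.Ioo F G).encard = 2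

namespace IsGraded

variable {n : ℕ} {P : Type*} [PartialOrder P] {r : P → ℕ}

/-- Climb from the least face: above a face of value `k` and below `x`, a face of smallest value has
value `k + 1`, since a larger jump would leave room for a face in between. -/
theorem exists_lt (h : IsGraded n P r) {x : P} : ∀ {k : ℕ}, k < r x → ∃ y < x, r y = k := by
  intro k
  induction k with
  | zero =>
    intro hx
    obtain ⟨b, hb, hb0⟩ := h.exists_bot
    exact ⟨b, lt_of_le_of_ne (hb x) (by rintro rfl; omega), hb0⟩
  | succ k ih =>
    intro hx
    obtain ⟨y, hyx, rfl⟩ := ih (by omega)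
    obtain ⟨z, hz, hmin⟩ := (measure r).wf.has_min (Set.Ioo y x) (h.nonempty_Ioo y x hyx hx)
    refine ⟨z, hz.2, ?_⟩
    by_contra hne
    have := h.strictMono hz.1
    obtain ⟨t, ht⟩ := h.nonempty_Ioo y z hz.1 (by omega)
    exact hmin t ⟨ht.1, ht.2.trans hz.2⟩ (h.strictMono ht.2)

/-- Strict monotonicity bounds the height by `r`, and `exists_lt` shows that no value is skipped. So
`r` is determined by the order, and the intrinsic `rank` can be computed from it. -/
theorem height_eq (h : IsGraded n P r) (x : P) : Order.height x = r x := by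
  rw [Order.height_eq_of_strictMono r h.strictMono (fun a b hb => h.exists_lt hb) x,
    Order.height_nat]

theorem rank_eq (h : IsGraded n P r) (x : P) : rank x = (r x : ℤ) - 1 := by
  simp [rank, h.height_eq]

/-- A flag skips no rank: if its next member `y` after `x` were too high, a face strictly between
`x` and `y` would be comparable with the whole flag and so belong to it. -/
theorem exists_mem_flag (h : IsGraded n P r) (s : Flag P) {k : ℕ} (hk : k ≤ n + 1) :
    ∃ x ∈ s, r x = k := by
  -- Maximality of the chain: whatever is comparable with all members is a member.
  have hmem : ∀ x : P, (∀ y ∈ s, x ≤ y ∨ y ≤ x) → x ∈ s := fun x hx => by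
    have := s.max_chain' (s := insert x (s : Set P)) (s.chain_le.insert fun y hy _ => hx y hy)
      (Set.subset_insert _ _)
    change x ∈ s.carrier
    rw [this]
    exact Set.mem_insert x _
  induction k with
  | zero =>
    obtain ⟨b, hb, hb0⟩ := h.exists_bot
    exact ⟨b, hmem b fun y _ => Or.inl (hb y), hb0⟩
  | succ k ih =>
    obtain ⟨x, hxs, rfl⟩ := ih (by omega)
    obtain ⟨t, ht, ht1⟩ := h.exists_top
    have hts : t ∈ s := hmem t fun y _ => Or.inr (ht y)
    have hxt : x < t := lt_of_le_of_ne (ht x) (by rintro rfl; omega)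
    obtain ⟨y, ⟨hys, hxy⟩, hmin⟩ := (measure r).wf.has_min {y | y ∈ s ∧ x < y} ⟨t, hts, hxt⟩
    refine ⟨y, hys, ?_⟩
    by_contra hne
    have := h.strictMono hxy
    obtain ⟨z, hz⟩ := h.nonempty_Ioo x y hxy (by omega)
    refine hmin z ⟨hmem z fun w hw => ?_, hz.1⟩ (h.strictMono hz.2)
    rcases s.le_or_le hxs hw with hxw | hwx
    · rcases hxw.eq_or_lt with rfl | hlt
      · exact Or.inr hz.1.le
      · left
        rcases s.le_or_le hys hw with hyw | hwy
        · exact hz.2.le.trans hyw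
        · rcases hwy.eq_or_lt with rfl | hwy
          · exact hz.2.le
          · exact absurd (h.strictMono hwy) (hmin w ⟨hw, hlt⟩)
    · exact Or.inr (hwx.trans hz.1.le)

/-- On a chain `r` is injective, and on a flag its image is all of `0, …, n + 1`. -/
theorem flag_card (h : IsGraded n P r) (s : Flag P) : (s : Set P).encard = n + 2 := by
  have hinj : Set.InjOn r (s : Set P) := by
    intro x hx y hy hxy
    rcases s.le_or_le hx hy with hle | hle
    · exact hle.eq_of_not_lt fun hlt => (h.strictMono hlt).ne hxy
    · exact (hle.eq_of_not_lt fun hlt => (h.strictMono hlt).ne hxy.symm).symm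
  rw [← hinj.encard_image]
  have : r '' (s : Set P) = (Finset.range (n + 2) : Set ℕ) := by
    ext k
    simp only [Set.mem_image, SetLike.mem_coe, Finset.coe_range, Set.mem_Iio]
    constructor
    · rintro ⟨x, -, rfl⟩
      obtain ⟨t, ht, ht1⟩ := h.exists_top
      have := h.strictMono.monotone (ht x)
      omega
    · intro hk
      exact h.exists_mem_flag s (by omega)
  rw [this, Set.encard_coe_eq_coe_finsetCard, Finset.card_range]
  norm_cast

theorem isPolytope (h : IsGraded n P r) : IsPolytope n P where
  exists_bot := h.exists_bot.imp fun _ hx => hx.1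
  exists_top := h.exists_top.imp fun _ hx => hx.1
  flag_card := h.flag_card
  connected F G hFG := by
    rw [SectionConnected, h.rank_eq, h.rank_eq]
    by_cases hr : r F + 2 < r G
    · right
      exact h.connected F G (hFG.lt_of_ne (by rintro rfl; omega)) hr
    · left
      omega
  diamond F G hFG := by
    rw [h.rank_eq, h.rank_eq]
    intro hr
    exact h.diamond F G (hFG.lt_of_ne (by rintro rfl; omega)) (by omega)

theorem of_orderIso (h : IsGraded n P r) {P' : Type*} [PartialOrder P'] (e : P' ≃o P) :
    IsGraded n P' (fun x => r (e x)) where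
  exists_bot := by
    obtain ⟨b, hb, hb0⟩ := h.exists_bot
    exact ⟨e.symm b, (isBot_orderIso_iff e.symm b).2 hb, by simpa using hb0⟩
  exists_top := by
    obtain ⟨t, ht, ht0⟩ := h.exists_top
    exact ⟨e.symm t, fun x => by rw [← e.le_iff_le]; simpa using ht _, by simpa using ht0⟩
  strictMono := h.strictMono.comp e.strictMono
  nonempty_Ioo F G hFG hr := by
    obtain ⟨x, hx⟩ := h.nonempty_Ioo _ _ (e.strictMono hFG) hr
    exact ⟨e.symm x, by rw [← e.lt_iff_lt]; simpa using hx.1,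
      by rw [← e.lt_iff_lt]; simpa using hx.2⟩
  connected F G hFG hr := by
    refine (h.connected _ _ (e.strictMono hFG) hr).image e.symm
      (fun x _ y _ hxy => e.symm.monotone hxy) (fun y hy => ⟨e y, ?_, by simp⟩) fun x hx => ?_
    · exact ⟨e.strictMono hy.1, e.strictMono hy.2⟩
    · exact ⟨by rw [← e.lt_iff_lt]; simpa using hx.1, by rw [← e.lt_iff_lt]; simpa using hx.2⟩
  diamond F G hFG hr := by
    rw [← h.diamond _ _ (e.strictMono hFG) hr, ← e.image_Ioo]
    exact (e.injective.encard_image _).symm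

theorem pt : IsGraded 0 Pt (fun b => b.toNat) where
  exists_bot := ⟨false, by simp [IsBot]⟩
  exists_top := ⟨true, by simp [IsTop, Bool.le_true]⟩
  strictMono := by
    intro a b
    revert a b
    decide
  nonempty_Ioo F G _ hr := by cases F <;> cases G <;> simp at hr
  connected F G _ hr := by cases F <;> cases G <;> simp at hr
  diamond F G _ hr := by cases F <;> cases G <;> simp at hr

/-- An interval of `P * pt` with constant second coordinate is an interval of `P`. The remaining
ones run from `(f, false)` to `(g, true)` and are treated directly. -/
theorem joinPt (h : IsGraded n P r) :
    IsGraded (n + 1) (Join P Pt) (fun x => r x.1 + x.2.toNat) where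
  exists_bot := by
    obtain ⟨b, hb, hb0⟩ := h.exists_bot
    exact ⟨(b, false), fun x => ⟨hb _, Bool.false_le _⟩, by simpa using hb0⟩
  exists_top := by
    obtain ⟨t, ht, ht0⟩ := h.exists_top
    exact ⟨(t, true), fun x => ⟨ht _, Bool.le_true _⟩, by simpa using ht0⟩
  strictMono := by
    intro x y hxy
    rcases Prod.lt_iff.1 hxy with ⟨h1, h2⟩ | ⟨h1, h2⟩
    · exact add_lt_add_of_lt_of_le (h.strictMono h1) (pt.strictMono.monotone h2)
    · exact add_lt_add_of_le_of_lt (h.strictMono.monotone h1) (pt.strictMono h2)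
  nonempty_Ioo := by
    rintro ⟨f, b⟩ ⟨g, c⟩ ⟨⟨h1, h2⟩, -⟩ hr
    simp only at h1 h2 hr
    have hfg : f < g := h1.lt_of_ne (by rintro rfl; have := Bool.toNat_le c; omega)
    rcases h2.eq_or_lt with rfl | hbc
    · obtain ⟨x, hx⟩ := h.nonempty_Ioo f g hfg (by omega)
      exact ⟨(x, b), Prod.mk_lt_mk_iff_left.2 hx.1, Prod.mk_lt_mk_iff_left.2 hx.2⟩
    · exact ⟨(f, c), Prod.mk_lt_mk_iff_right.2 hbc, Prod.mk_lt_mk_iff_left.2 hfg⟩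
  connected := by
    rintro ⟨f, b⟩ ⟨g, c⟩ ⟨⟨h1, h2⟩, -⟩ hr
    simp only at h1 h2 hr
    have hfg : f < g := h1.lt_of_ne (by rintro rfl; have := Bool.toNat_le c; omega)
    rcases h2.eq_or_lt with rfl | hbc
    · refine (h.connected f g hfg (by omega)).image (fun x => (x, b)) (fun x _ y _ hxy => ?_)
        (fun y hy => ?_) (fun x hx => ?_)
      · exact ⟨hxy, le_rfl⟩
      · obtain ⟨y, c⟩ := y
        obtain rfl : b = c := le_antisymm hy.1.le.2 hy.2.le.2
        exact ⟨y, ⟨Prod.mk_lt_mk_iff_left.1 hy.1, Prod.mk_lt_mk_iff_left.1 hy.2⟩, rfl⟩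
      · exact ⟨Prod.mk_lt_mk_iff_left.2 hx.1, Prod.mk_lt_mk_iff_left.2 hx.2⟩
    · obtain ⟨rfl, rfl⟩ := Bool.lt_iff.1 hbc
      obtain ⟨m, hm⟩ := h.nonempty_Ioo f g hfg (by simp at hr; omega)
      have h0 : ∀ {x}, f < x → x ≤ g → (x, false) ∈ Set.Ioo (f, false) (g, true) :=
        fun hx hx' => ⟨Prod.mk_lt_mk_iff_left.2 hx, Prod.mk_lt_mk_of_le_of_lt hx' hbc⟩
      have h1 : ∀ {x}, f ≤ x → x < g → (x, true) ∈ Set.Ioo (f, false) (g, true) :=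
        fun hx hx' => ⟨Prod.mk_lt_mk_of_le_of_lt hx hbc, Prod.mk_lt_mk_iff_left.2 hx'⟩
      have hg := h0 hfg le_rfl
      -- The hub lies above all `(x, false)`. From `(x, true)` it is reached through `(f, true)`,
      -- `(m, true)` and `(m, false)`, where `f < m < g`.
      refine ConnectedIn.of_hub (g, false) ?_
      rintro ⟨x, b⟩ hx
      cases b
      · exact Incident.of_le hx hg (Prod.mk_le_mk.2 ⟨hx.2.le.1, le_rfl⟩)
      · have hf := h1 le_rfl hfg
        refine (Incident.of_ge hx hf (Prod.mk_le_mk.2 ⟨hx.1.le.1, le_rfl⟩)).trans ?_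
        refine (Incident.of_le hf (h1 hm.1.le hm.2)
          (Prod.mk_le_mk.2 ⟨hm.1.le, le_rfl⟩)).trans ?_
        refine (Incident.of_ge (h1 hm.1.le hm.2) (h0 hm.1 hm.2.le)
          (Prod.mk_le_mk.2 ⟨le_rfl, hbc.le⟩)).trans ?_
        exact Incident.of_le (h0 hm.1 hm.2.le) hg (Prod.mk_le_mk.2 ⟨hm.2.le, le_rfl⟩)
  diamond := by
    rintro ⟨f, b⟩ ⟨g, c⟩ ⟨⟨h1, h2⟩, -⟩ hr
    simp only at h1 h2 hr
    have hfg : f < g := h1.lt_of_ne (by rintro rfl; have := Bool.toNat_le c; omega)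
    rcases h2.eq_or_lt with rfl | hbc
    · rw [← h.diamond f g hfg (by omega),
        ← (Prod.mk_left_injective b).encard_image (Set.Ioo f g)]
      refine congrArg Set.encard (Set.ext ?_)
      rintro ⟨x, c⟩
      constructor
      · intro hx
        obtain rfl : b = c := le_antisymm hx.1.le.2 hx.2.le.2
        exact ⟨x, ⟨Prod.mk_lt_mk_iff_left.1 hx.1, Prod.mk_lt_mk_iff_left.1 hx.2⟩, rfl⟩
      · rintro ⟨x, hx, ⟨⟩⟩
        exact ⟨Prod.mk_lt_mk_iff_left.2 hx.1, Prod.mk_lt_mk_iff_left.2 hx.2⟩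
    · obtain ⟨rfl, rfl⟩ := Bool.lt_iff.1 hbc
      -- The rank difference 2 is used up by one step in each coordinate, so `g` covers `f`, and
      -- only the two mixed corners remain.
      have hcov : ∀ x, f < x → x < g → False := fun x hx hx' => by
        have := h.strictMono hx
        have := h.strictMono hx'
        simp at hr
        omega
      refine Set.encard_eq_two.2 ⟨(f, true), (g, false), by simp, ?_⟩
      ext ⟨x, c⟩
      constructor
      · intro hx
        cases c
        · have hfx := Prod.mk_lt_mk_iff_left.1 hx.1
          rcases (show x ≤ g from hx.2.le.1).eq_or_lt with rfl | hxg
          · simp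
          · exact (hcov x hfx hxg).elim
        · have hxg := Prod.mk_lt_mk_iff_left.1 hx.2
          rcases (show f ≤ x from hx.1.le.1).eq_or_lt with rfl | hfx
          · simp
          · exact (hcov x hfx hxg).elim
      · rintro (⟨⟨⟩⟩ | ⟨⟨⟩⟩)
        · exact ⟨Prod.mk_lt_mk_iff_right.2 hbc, Prod.mk_lt_mk_iff_left.2 hfg⟩
        · exact ⟨Prod.mk_lt_mk_iff_left.2 hfg, Prod.mk_lt_mk_iff_right.2 hbc⟩

end IsGraded

/-! ## Cartesian products with an edge -/

theorem edge_cases (s : Edge) : s = ∅ ∨ (∃ z, s = {z}) ∨ s = Finset.univ := by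
  revert s
  decide

theorem isBot_edge_iff {s : Edge} : IsBot s ↔ s = ∅ := by
  rw [isBot_iff_eq_bot, Finset.bot_eq_empty]

namespace CartProd

variable {P Q : Type*} [PartialOrder P] [PartialOrder Q]

/-- The pair of two faces that are not the least ones. -/
def pair (p : P) (q : Q) (hp : ¬ IsBot p) (hq : ¬ IsBot q) : CartProd P Q :=
  ⟨(p, q), Or.inl ⟨hp, hq⟩⟩

/-- The pair of the two least faces. -/
def pairBot (p : P) (q : Q) (hp : IsBot p) (hq : IsBot q) : CartProd P Q :=
  ⟨(p, q), Or.inr ⟨hp, hq⟩⟩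

section Pair

variable {p p' : P} {q q' : Q} {hp : ¬ IsBot p} {hq : ¬ IsBot q} {hp' : ¬ IsBot p'}
  {hq' : ¬ IsBot q'}

theorem pair_le_pair : pair p q hp hq ≤ pair p' q' hp' hq' ↔ p ≤ p' ∧ q ≤ q' :=
  Iff.rfl

theorem pair_inj : pair p q hp hq = pair p' q' hp' hq' ↔ p = p' ∧ q = q' :=
  Subtype.ext_iff.trans Prod.mk_inj

theorem pair_lt_pair :
    pair p q hp hq < pair p' q' hp' hq' ↔ p < p' ∧ q ≤ q' ∨ p ≤ p' ∧ q < q' :=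
  Prod.mk_lt_mk

theorem not_isBot_pair : ¬ IsBot (pair p q hp hq) := by
  rw [← isBot_fst_iff]
  exact hp

theorem isTop_pair (hpt : IsTop p) (hqt : IsTop q) : IsTop (pair p q hp hq) :=
  fun _ => ⟨hpt _, hqt _⟩

end Pair

theorem isBot_snd_iff (x : CartProd P Q) : IsBot x.1.2 ↔ IsBot x := by
  rw [← isBot_fst_iff]
  rcases x.2 with h | h
  · exact ⟨fun h' => (h.2 h').elim, fun h' => (h.1 h').elim⟩
  · exact ⟨fun _ => h.1, fun _ => h.2⟩

/-- A face of a Cartesian product is the least one or a pair. -/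
theorem cases (x : CartProd P Q) : IsBot x ∨ ∃ p q hp hq, x = pair p q hp hq := by
  rcases x.2 with h | h
  · exact Or.inr ⟨_, _, h.1, h.2, rfl⟩
  · exact Or.inl ((isBot_fst_iff x).1 h.1)

theorem exists_eq_pair {x : CartProd P Q} (hx : ¬ IsBot x) : ∃ p q hp hq, x = pair p q hp hq :=
  x.cases.resolve_left hx

end CartProd

theorem IsBot.lt_of_not {P : Type*} [PartialOrder P] {x y : P} (hx : IsBot x)
    (hy : ¬ IsBot y) : x < y :=
  (hx y).lt_of_ne fun h => hy (h ▸ hx)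

theorem IsBot.eq {P : Type*} [PartialOrder P] {x y : P} (hx : IsBot x) (hy : IsBot y) : x = y :=
  le_antisymm (hx y) (hy x)

theorem not_isBot_of_lt {P : Type*} [PartialOrder P] {x y : P} (h : x < y) : ¬ IsBot y :=
  fun hy => h.not_ge (hy x)

theorem not_isBot_of_le {P : Type*} [PartialOrder P] {x y : P} (h : x ≤ y) (hx : ¬ IsBot x) :
    ¬ IsBot y :=
  fun hy => hx ((le_antisymm h (hy x)).symm ▸ hy)

theorem not_isBot_singleton (z : ZMod 2) : ¬ IsBot ({z} : Edge) := by
  rw [isBot_edge_iff]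
  exact Finset.singleton_ne_empty z

theorem not_isBot_univ : ¬ IsBot (Finset.univ : Edge) := by
  rw [isBot_edge_iff]
  decide

theorem singleton_lt_univ (z : ZMod 2) : ({z} : Edge) < Finset.univ := by
  revert z
  decide

/-- A face of the edge that is not the least one is a vertex or the greatest face. -/
theorem edge_cases_of_not_isBot {s : Edge} (hs : ¬ IsBot s) :
    (∃ z, s = {z}) ∨ s = Finset.univ :=
  (edge_cases s).resolve_left fun h => hs (isBot_edge_iff.2 h)

theorem edge_cases_of_lt {s t : Edge} (hs : ¬ IsBot s) (h : s < t) :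
    (∃ z, s = {z}) ∧ t = Finset.univ := by
  rw [isBot_edge_iff] at hs
  revert s t
  decide

theorem eq_singleton_of_le {s : Edge} {z : ZMod 2} (hs : ¬ IsBot s) (h : s ≤ {z}) : s = {z} := by
  rw [isBot_edge_iff] at hs
  revert s z
  decide

namespace CartProd

variable {P : Type*} [PartialOrder P]

open Classical in
/-- The embedding of `P` into `P × I` with second coordinate `s`. -/
noncomputable def lift (s : Edge) (hs : ¬ IsBot s) (x : P) : CartProd P Edge :=
  if h : IsBot x then pairBot x ∅ h (isBot_edge_iff.2 rfl) else pair x s h hs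

variable {s : Edge} {hs : ¬ IsBot s}

theorem lift_of_not_isBot {x : P} (hx : ¬ IsBot x) : lift s hs x = pair x s hx hs :=
  dif_neg hx

theorem fst_lift (x : P) : (lift s hs x).1.1 = x := by
  by_cases h : IsBot x
  · have : lift s hs x = pairBot x ∅ h (isBot_edge_iff.2 rfl) := dif_pos h
    rw [this, pairBot]
  · rw [lift_of_not_isBot h, pair]

theorem isBot_lift {x : P} (hx : IsBot x) : IsBot (lift s hs x) := by
  rw [← isBot_fst_iff, fst_lift]
  exact hx

theorem lift_le_lift {x y : P} : lift s hs x ≤ lift s hs y ↔ x ≤ y := by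
  constructor
  · intro h
    have := h.1
    rwa [fst_lift, fst_lift] at this
  · intro h
    by_cases hx : IsBot x
    · exact isBot_lift hx _
    · rw [lift_of_not_isBot hx, lift_of_not_isBot (not_isBot_of_le h hx)]
      exact ⟨h, le_rfl⟩

theorem lift_lt_lift {x y : P} : lift s hs x < lift s hs y ↔ x < y :=
  lt_iff_lt_of_le_iff_le' lift_le_lift lift_le_lift

theorem lift_injective : Function.Injective (lift s hs : P → CartProd P Edge) :=
  fun _ _ h => le_antisymm (lift_le_lift.1 h.le) (lift_le_lift.1 h.ge)

/-- The hypothesis forces the second coordinate of an intermediate face to be `s`. For `f` least and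
`s` the whole edge this fails: faces over the two vertices of the edge would also lie in the
interval. -/
theorem image_lift_Ioo {f g : P} (h : ¬ IsBot f ∨ ∃ z, s = {z}) :
    lift s hs '' Set.Ioo f g = Set.Ioo (lift s hs f) (lift s hs g) := by
  ext y
  constructor
  · rintro ⟨x, hx, rfl⟩
    exact ⟨lift_lt_lift.2 hx.1, lift_lt_lift.2 hx.2⟩
  · intro hy
    obtain ⟨x, t, hx, ht, rfl⟩ := exists_eq_pair (not_isBot_of_lt hy.1)
    have hg : ¬ IsBot g := fun hg => not_isBot_of_lt hy.2 (isBot_lift hg)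
    have hts : t = s := by
      have h2 := hy.2.le
      rw [lift_of_not_isBot hg] at h2
      rcases h with hf | ⟨z, rfl⟩
      · have h1 := hy.1.le
        rw [lift_of_not_isBot hf] at h1
        exact le_antisymm h2.2 h1.2
      · exact eq_singleton_of_le ht h2.2
    subst hts
    rw [← lift_of_not_isBot (hs := ht) hx] at hy ⊢
    exact ⟨x, ⟨lift_lt_lift.1 hy.1, lift_lt_lift.1 hy.2⟩, rfl⟩

/-- The three kinds of intervals in `P × I`. -/
theorem interval_cases {F G : CartProd P Edge} (h : F < G) :
    (∃ s hs f g, f < g ∧ (¬ IsBot f ∨ ∃ z, s = {z}) ∧ F = lift s hs f ∧ G = lift s hs g) ∨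
    (∃ z f g hf hg, f ≤ g ∧ F = pair f {z} hf (not_isBot_singleton z) ∧
      G = pair g Finset.univ hg not_isBot_univ) ∨
    (IsBot F ∧ ∃ g hg, G = pair g Finset.univ hg not_isBot_univ) := by
  obtain ⟨g, t, hg, ht, rfl⟩ := exists_eq_pair (not_isBot_of_lt h)
  rcases F.cases with hF | ⟨f, s, hf, hs, rfl⟩
  · rcases edge_cases_of_not_isBot ht with ⟨z, rfl⟩ | rfl
    · have hF1 := (isBot_fst_iff F).2 hF
      exact Or.inl ⟨{z}, ht, F.1.1, g, hF1.lt_of_not hg, Or.inr ⟨z, rfl⟩,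
        hF.eq (isBot_lift hF1), (lift_of_not_isBot hg).symm⟩
    · exact Or.inr (Or.inr ⟨hF, g, hg, rfl⟩)
  · obtain ⟨h1, h2⟩ := pair_le_pair.1 h.le
    rcases h2.eq_or_lt with rfl | hst
    · refine Or.inl ⟨s, hs, f, g, h1.lt_of_ne ?_, Or.inl hf, (lift_of_not_isBot hf).symm,
        (lift_of_not_isBot hg).symm⟩
      rintro rfl
      exact lt_irrefl _ h
    · obtain ⟨⟨z, rfl⟩, rfl⟩ := edge_cases_of_lt hs hst
      exact Or.inr (Or.inl ⟨z, f, g, hf, hg, h1, rfl, rfl⟩)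

/-- The rank function of `P × I`. -/
def edgeRank (r : P → ℕ) (x : CartProd P Edge) : ℕ := r x.1.1 + x.1.2.card - 1

theorem edgeRank_singleton (r : P → ℕ) {p : P} {z : ZMod 2} {hp : ¬ IsBot p}
    {hs : ¬ IsBot ({z} : Edge)} : edgeRank r (pair p {z} hp hs) = r p :=
  rfl

theorem edgeRank_univ (r : P → ℕ) {p : P} {hp : ¬ IsBot p}
    {hs : ¬ IsBot (Finset.univ : Edge)} : edgeRank r (pair p Finset.univ hp hs) = r p + 1 :=
  rfl

end CartProd

namespace IsGraded

open CartProd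

variable {n : ℕ} {P : Type*} [PartialOrder P] {r : P → ℕ}

theorem isBot_iff (h : IsGraded n P r) (x : P) : IsBot x ↔ r x = 0 := by
  obtain ⟨b, hb, hb0⟩ := h.exists_bot
  constructor
  · intro hx
    rw [hx.eq hb, hb0]
  · intro hx
    by_contra hx'
    have := h.strictMono (hb.lt_of_not hx')
    omega

theorem edgeRank_bot (h : IsGraded n P r) {x : CartProd P Edge} (hx : IsBot x) :
    edgeRank r x = 0 := by
  -- At the least face the subtraction in `edgeRank` is truncated: `0 + 0 - 1 = 0`, the value
  -- required there.
  rw [edgeRank, (h.isBot_iff _).1 ((isBot_fst_iff x).2 hx),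
    isBot_edge_iff.1 ((isBot_snd_iff x).2 hx), Finset.card_empty]

theorem edgeRank_lift (h : IsGraded n P r) {s : Edge} {hs : ¬ IsBot s} {f g : P}
    (hf : ¬ IsBot f ∨ ∃ z, s = {z}) (hfg : f < g) :
    edgeRank r (lift s hs g) + r f = edgeRank r (lift s hs f) + r g := by
  have hg := not_isBot_of_lt hfg
  rw [lift_of_not_isBot hg]
  by_cases hf' : IsBot f
  · obtain ⟨z, rfl⟩ := hf.resolve_left (not_not.2 hf')
    rw [h.edgeRank_bot (isBot_lift hf'), (h.isBot_iff f).1 hf', edgeRank_singleton, add_comm]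
  · rw [lift_of_not_isBot hf']
    rcases edge_cases_of_not_isBot hs with ⟨z, rfl⟩ | rfl
    · rw [edgeRank_singleton, edgeRank_singleton, add_comm]
    · rw [edgeRank_univ, edgeRank_univ]
      omega

theorem edgeRank_strictMono (h : IsGraded n P r) : StrictMono (edgeRank r) := by
  intro F G hFG
  rcases interval_cases hFG with ⟨s, hs, f, g, hfg, hf, rfl, rfl⟩ |
    ⟨z, f, g, hf, hg, hfg, rfl, rfl⟩ | ⟨hF, g, hg, rfl⟩
  · have := h.edgeRank_lift (hs := hs) hf hfg
    have := h.strictMono hfg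
    omega
  · have := h.strictMono.monotone hfg
    rw [edgeRank_singleton, edgeRank_univ]
    omega
  · rw [h.edgeRank_bot hF, edgeRank_univ]
    omega

/-- Each axiom is checked on the three kinds of intervals: lifted copies of intervals of `P`,
intervals from a copy of `P` over a vertex up to the whole edge (which look like those of `P * pt`),
and intervals from the least face up to the whole edge. -/
theorem timesEdge (h : IsGraded n P r) : IsGraded (n + 1) (CartProd P Edge) (edgeRank r) where
  exists_bot := by
    obtain ⟨b, hb, hb0⟩ := h.exists_bot
    have := isBot_lift (hs := not_isBot_univ) hb
    exact ⟨_, this, h.edgeRank_bot this⟩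
  exists_top := by
    obtain ⟨t, ht, ht0⟩ := h.exists_top
    refine ⟨pair t Finset.univ (by rw [h.isBot_iff]; omega) not_isBot_univ,
      isTop_pair ht fun s => Finset.subset_univ s, ?_⟩
    rw [edgeRank_univ, ht0]
  strictMono := h.edgeRank_strictMono
  nonempty_Ioo F G hFG hr := by
    rcases interval_cases hFG with ⟨s, hs, f, g, hfg, hf, rfl, rfl⟩ |
      ⟨z, f, g, hf, hg, hfg, rfl, rfl⟩ | ⟨hF, g, hg, rfl⟩
    · have := h.edgeRank_lift (hs := hs) hf hfg
      rw [← image_lift_Ioo hf]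
      exact (h.nonempty_Ioo f g hfg (by omega)).image _
    · rw [edgeRank_singleton, edgeRank_univ] at hr
      have hlt : f < g := hfg.lt_of_ne (by rintro rfl; omega)
      exact ⟨pair f Finset.univ hf not_isBot_univ,
        pair_lt_pair.2 (Or.inr ⟨le_rfl, singleton_lt_univ z⟩),
        pair_lt_pair.2 (Or.inl ⟨hlt, le_rfl⟩)⟩
    · exact ⟨pair g {0} hg (not_isBot_singleton 0), hF.lt_of_not not_isBot_pair,
        pair_lt_pair.2 (Or.inr ⟨le_rfl, singleton_lt_univ 0⟩)⟩
  connected F G hFG hr := by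
    rcases interval_cases hFG with ⟨s, hs, f, g, hfg, hf, rfl, rfl⟩ |
      ⟨z, f, g, hf, hg, hfg, rfl, rfl⟩ | ⟨hF, g, hg, rfl⟩
    · have := h.edgeRank_lift (hs := hs) hf hfg
      rw [← image_lift_Ioo hf]
      exact (h.connected f g hfg (by omega)).image (lift s hs)
        (fun x _ y _ hxy => lift_le_lift.2 hxy) (fun _ hy => hy)
        (fun x hx => Set.mem_image_of_mem _ hx)
    · rw [edgeRank_singleton, edgeRank_univ] at hr
      have hlt : f < g := hfg.lt_of_ne (by rintro rfl; omega)
      obtain ⟨m, hm⟩ := h.nonempty_Ioo f g hlt (by omega)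
      have h0 : ∀ x (hx : ¬ IsBot x), f < x → x ≤ g →
          pair x {z} hx (not_isBot_singleton z) ∈ Set.Ioo (pair f {z} hf (not_isBot_singleton z))
            (pair g Finset.univ hg not_isBot_univ) := fun x hx h1 h2 =>
        ⟨pair_lt_pair.2 (Or.inl ⟨h1, le_rfl⟩), pair_lt_pair.2 (Or.inr ⟨h2, singleton_lt_univ z⟩)⟩
      have h1 : ∀ x (hx : ¬ IsBot x), f ≤ x → x < g →
          pair x Finset.univ hx not_isBot_univ ∈ Set.Ioo (pair f {z} hf (not_isBot_singleton z))
            (pair g Finset.univ hg not_isBot_univ) := fun x hx h1 h2 =>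
        ⟨pair_lt_pair.2 (Or.inr ⟨h1, singleton_lt_univ z⟩), pair_lt_pair.2 (Or.inl ⟨h2, le_rfl⟩)⟩
      have hm' := not_isBot_of_lt hm.1
      have hg' := h0 g hg hlt le_rfl
      refine ConnectedIn.of_hub (pair g {z} hg (not_isBot_singleton z)) fun y hy => ?_
      obtain ⟨x, t, hx, ht, rfl⟩ := exists_eq_pair (not_isBot_of_lt hy.1)
      rcases edge_cases_of_not_isBot ht with ⟨z', rfl⟩ | rfl
      · have : z = z' := Finset.singleton_subset_singleton.1 hy.1.le.2
        subst this
        exact Incident.of_le hy hg' (pair_le_pair.2 ⟨hy.2.le.1, le_rfl⟩)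
      · refine (Incident.of_ge hy (h1 f hf le_rfl hlt) (pair_le_pair.2 ⟨hy.1.le.1, le_rfl⟩)).trans ?_
        refine (Incident.of_le (h1 f hf le_rfl hlt) (h1 m hm' hm.1.le hm.2)
          (pair_le_pair.2 ⟨hm.1.le, le_rfl⟩)).trans ?_
        refine (Incident.of_ge (h1 m hm' hm.1.le hm.2) (h0 m hm' hm.1 hm.2.le)
          (pair_le_pair.2 ⟨le_rfl, (singleton_lt_univ z).le⟩)).trans ?_
        exact Incident.of_le (h0 m hm' hm.1 hm.2.le) hg' (pair_le_pair.2 ⟨hm.2.le, le_rfl⟩)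
    · rw [h.edgeRank_bot hF, edgeRank_univ] at hr
      -- A vertex `m` of `P` below `g`. The face `m × I` connects the two ends `g × {0}` and `g ×
      -- {1}`, and every other face of the interval reaches one of these ends.
      obtain ⟨m, hmg, hm1⟩ := h.exists_lt (x := g) (k := 1) (by omega)
      have hm : ¬ IsBot m := by rw [h.isBot_iff]; omega
      have h0 : ∀ x (hx : ¬ IsBot x) (z : ZMod 2), x ≤ g →
          pair x {z} hx (not_isBot_singleton z) ∈ Set.Ioo F
            (pair g Finset.univ hg not_isBot_univ) := fun x hx z h1 =>
        ⟨hF.lt_of_not not_isBot_pair, pair_lt_pair.2 (Or.inr ⟨h1, singleton_lt_univ z⟩)⟩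
      have h1 : ∀ x (hx : ¬ IsBot x), x < g →
          pair x Finset.univ hx not_isBot_univ ∈ Set.Ioo F
            (pair g Finset.univ hg not_isBot_univ) := fun x hx h1 =>
        ⟨hF.lt_of_not not_isBot_pair, pair_lt_pair.2 (Or.inl ⟨h1, le_rfl⟩)⟩
      have hub : ∀ z : ZMod 2, Relation.ReflTransGen (Incident (Set.Ioo F
          (pair g Finset.univ hg not_isBot_univ))) (pair g {z} hg (not_isBot_singleton z))
          (pair m Finset.univ hm not_isBot_univ) := fun z =>
        (Incident.of_ge (h0 g hg z le_rfl) (h0 m hm z hmg.le) (pair_le_pair.2 ⟨hmg.le, le_rfl⟩)).trans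
          (Incident.of_le (h0 m hm z hmg.le) (h1 m hm hmg) (pair_le_pair.2 ⟨le_rfl, (singleton_lt_univ z).le⟩))
      refine ConnectedIn.of_hub (pair m Finset.univ hm not_isBot_univ) fun y hy => ?_
      obtain ⟨x, t, hx, ht, rfl⟩ := exists_eq_pair (not_isBot_of_lt hy.1)
      rcases edge_cases_of_not_isBot ht with ⟨z, rfl⟩ | rfl
      · exact (Incident.of_le hy (h0 g hg z le_rfl) (pair_le_pair.2 ⟨hy.2.le.1, le_rfl⟩)).trans (hub z)
      · refine (Incident.of_ge hy (h0 x hx 0 hy.2.le.1)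
          (pair_le_pair.2 ⟨le_rfl, (singleton_lt_univ 0).le⟩)).trans ?_
        exact (Incident.of_le (h0 x hx 0 hy.2.le.1) (h0 g hg 0 le_rfl)
          (pair_le_pair.2 ⟨hy.2.le.1, le_rfl⟩)).trans (hub 0)
  diamond F G hFG hr := by
    rcases interval_cases hFG with ⟨s, hs, f, g, hfg, hf, rfl, rfl⟩ |
      ⟨z, f, g, hf, hg, hfg, rfl, rfl⟩ | ⟨hF, g, hg, rfl⟩
    · have := h.edgeRank_lift (hs := hs) hf hfg
      rw [← image_lift_Ioo hf, lift_injective.encard_image]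
      exact h.diamond f g hfg (by omega)
    · rw [edgeRank_singleton, edgeRank_univ] at hr
      have hlt : f < g := hfg.lt_of_ne (by rintro rfl; omega)
      have hcov : ∀ x, f < x → x < g → False := fun x hx hx' => by
        have := h.strictMono hx
        have := h.strictMono hx'
        omega
      refine Set.encard_eq_two.2 ⟨pair f Finset.univ hf not_isBot_univ,
        pair g {z} hg (not_isBot_singleton z), fun he => hlt.ne (pair_inj.1 he).1, ?_⟩
      ext y
      constructor
      · intro hy
        obtain ⟨x, t, hx, ht, rfl⟩ := exists_eq_pair (not_isBot_of_lt hy.1)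
        have h1 : f ≤ x := hy.1.le.1
        have h2 : x ≤ g := hy.2.le.1
        rcases edge_cases_of_not_isBot ht with ⟨z', rfl⟩ | rfl
        · have : z = z' := Finset.singleton_subset_singleton.1 hy.1.le.2
          subst this
          rcases h2.eq_or_lt with rfl | h2
          · exact Or.inr rfl
          · rcases h1.eq_or_lt with rfl | h1
            · exact (lt_irrefl _ hy.1).elim
            · exact (hcov x h1 h2).elim
        · rcases h1.eq_or_lt with rfl | h1
          · exact Or.inl rfl
          · rcases h2.eq_or_lt with rfl | h2
            · exact (lt_irrefl _ hy.2).elim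
            · exact (hcov x h1 h2).elim
      · rintro (rfl | rfl)
        · exact ⟨pair_lt_pair.2 (Or.inr ⟨le_rfl, singleton_lt_univ z⟩),
            pair_lt_pair.2 (Or.inl ⟨hlt, le_rfl⟩)⟩
        · exact ⟨pair_lt_pair.2 (Or.inl ⟨hlt, le_rfl⟩),
            pair_lt_pair.2 (Or.inr ⟨le_rfl, singleton_lt_univ z⟩)⟩
    · rw [h.edgeRank_bot hF, edgeRank_univ] at hr
      refine Set.encard_eq_two.2 ⟨pair g {0} hg (not_isBot_singleton 0),
        pair g {1} hg (not_isBot_singleton 1), fun he => ?_, ?_⟩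
      · exact absurd (pair_inj.1 he).2 (by decide)
      · ext y
        constructor
        · intro hy
          obtain ⟨x, t, hx, ht, rfl⟩ := exists_eq_pair (not_isBot_of_lt hy.1)
          -- Here `r g = 1`, so `g` is a vertex and the section is a single edge over it.
          have hxg : x = g := (show x ≤ g from hy.2.le.1).eq_of_not_lt fun hlt => by
            have := h.strictMono hlt
            rw [h.isBot_iff] at hx
            omega
          subst hxg
          rcases edge_cases_of_not_isBot ht with ⟨z, rfl⟩ | rfl
          · fin_cases z
            · exact Or.inl rfl
            · exact Or.inr rfl
          · exact (lt_irrefl _ hy.2).elim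
        · rintro (rfl | rfl)
          · exact ⟨hF.lt_of_not not_isBot_pair,
              pair_lt_pair.2 (Or.inr ⟨le_rfl, singleton_lt_univ 0⟩)⟩
          · exact ⟨hF.lt_of_not not_isBot_pair,
              pair_lt_pair.2 (Or.inr ⟨le_rfl, singleton_lt_univ 1⟩)⟩

end IsGraded

/-! ## Polytopes of small rank -/

namespace IsPolytope

variable {n m : ℕ} {P : Type*} [PartialOrder P]

theorem encard_chain_le (h : IsPolytope n P) {s : Set P} (hs : IsChain (· ≤ ·) s) :
    s.encard ≤ n + 2 := by
  obtain ⟨t, hst⟩ := hs.exists_subset_flag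
  exact (Set.encard_le_encard hst).trans (h.flag_card t).le

theorem rank_unique (h : IsPolytope n P) (h' : IsPolytope m P) : n = m := by
  obtain ⟨t, -⟩ := (IsChain.empty (r := (· ≤ ·)) (α := P)).exists_subset_flag
  have := (h.flag_card t).symm.trans (h'.flag_card t)
  norm_cast at this
  omega

/-- A strict chain of faces lies in a flag, so its length is bounded. Finiteness is what allows
faces of every smaller height to be found below `x`. -/
theorem height_lt_top (h : IsPolytope n P) (x : P) : Order.height x < ⊤ := by
  refine lt_of_le_of_lt (b := ((n + 2 : ℕ) : ℕ∞)) ?_ (ENat.natCast_lt_top _)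
  refine Order.height_le fun p _ => ?_
  have hchain : IsChain (· ≤ ·) (Set.range p) := by
    rintro _ ⟨i, rfl⟩ _ ⟨j, rfl⟩ -
    exact (le_total i j).imp (fun h => p.monotone h) (fun h => p.monotone h)
  have := h.encard_chain_le hchain
  rw [← Set.image_univ, p.strictMono.injective.encard_image, Set.encard_univ,
    ENat.card_eq_coe_fintype_card, Fintype.card_fin] at this
  norm_cast at this ⊢
  omega

/-- Otherwise a flag would have at most the two elements `b` and `t`, fewer than `n + 2`. -/
theorem exists_between (h : IsPolytope n P) (hn : 1 ≤ n) {b t : P} (hb : IsBot b)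
    (ht : IsTop t) : ∃ x, b < x ∧ x < t := by
  obtain ⟨s, -⟩ := (IsChain.empty (r := (· ≤ ·)) (α := P)).exists_subset_flag
  by_contra! hx
  have hsub : (s : Set P) ⊆ {b, t} := by
    intro x _
    rcases (hb x).eq_or_lt with rfl | hlt
    · exact Or.inl rfl
    · exact Or.inr ((ht x).eq_of_not_lt (hx x hlt))
  have h1 := (Set.encard_le_encard hsub).trans (Set.encard_insert_le _ _)
  rw [h.flag_card s, Set.encard_singleton] at h1
  norm_cast at h1
  omega

theorem not_bot_covBy_top (h : IsPolytope n P) (hn : 1 ≤ n) {b t : P} (hb : IsBot b)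
    (ht : IsTop t) : ¬ b ⋖ t := fun hc => by
  obtain ⟨x, hx⟩ := h.exists_between hn hb ht
  exact hc.2 hx.1 hx.2

/-- Apply the diamond condition between `b` and a face `G` of height 2. The two faces found are
atoms, since a face below one of them would give `G` height at least 3. -/
theorem exists_two_atoms (h : IsPolytope n P) (hn : 1 ≤ n) {b : P} (hb : IsBot b) :
    ∃ x y, x ≠ y ∧ b ⋖ x ∧ b ⋖ y := by
  obtain ⟨t, ht⟩ := h.exists_top
  obtain ⟨x, hbx, hxt⟩ := h.exists_between hn hb ht
  have hb0 : Order.height b = 0 := Order.height_eq_zero.2 fun y _ => hb y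
  obtain ⟨G, hG⟩ : ∃ G : P, Order.height G = 2 := by
    have h1 := Order.height_add_one_le hbx
    have h2 := Order.height_add_one_le hxt
    have h3 : ((2 : ℕ) : ℕ∞) ≤ Order.height t := by
      rw [hb0, zero_add] at h1
      refine le_trans ?_ h2
      exact add_le_add_left h1 1
    rcases h3.eq_or_lt with h3 | h3
    · exact ⟨t, h3.symm⟩
    · obtain ⟨y, -, hy⟩ := (Order.coe_lt_height_iff (h.height_lt_top t)).1 h3
      exact ⟨y, hy⟩
  have hrank : rank G - rank b = 2 := by
    rw [rank, rank, hG, hb0]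
    norm_num
  obtain ⟨x, y, hxy, hI⟩ := Set.encard_eq_two.1 (h.diamond b G (hb G) hrank)
  have hmin : ∀ z ∈ Set.Ioo b G, b ⋖ z := by
    refine fun z hz => ⟨hz.1, fun w hw hwz => ?_⟩
    have h1 := Order.height_add_one_le hw
    have h2 := Order.height_add_one_le hwz
    have h3 := Order.height_add_one_le hz.2
    rw [hG] at h3
    rw [hb0] at h1
    have h4 : ((3 : ℕ) : ℕ∞) ≤ ((2 : ℕ) : ℕ∞) := by
      refine le_trans ?_ h3
      refine le_trans ?_ (add_le_add_left h2 1)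
      exact le_trans (by norm_num) (add_le_add_left (add_le_add_left h1 1) 1)
    norm_cast at h4
  exact ⟨x, y, hxy, hmin x (hI ▸ Set.mem_insert x _),
    hmin y (hI ▸ Set.mem_insert_of_mem _ rfl)⟩

-- A chain of three faces is impossible in rank 0. This special case suffices for general polytopes:
-- it determines the rank of a pyramid or prism whose base has rank 0, and so excludes such a base
-- when the rank is at least 2.
open Classical in
theorem isGraded_zero (h : IsPolytope 0 P) :
    IsGraded 0 P (fun x => if IsBot x then 0 else 1) := by
  obtain ⟨b, hb⟩ := h.exists_bot
  obtain ⟨t, ht⟩ := h.exists_top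
  have hle : ∀ x : P, (if IsBot x then 0 else 1) ≤ 1 := fun x => by split_ifs <;> omega
  have key : ∀ x y z : P, x < y → y < z → False := fun x y z hxy hyz => by
    have hc : IsChain (· ≤ ·) ({x, y, z} : Set P) := by
      have := hxy.le
      have := hyz.le
      have := (hxy.trans hyz).le
      rintro u (rfl | rfl | rfl) v (rfl | rfl | rfl) _ <;> simp [*]
    have := h.encard_chain_le hc
    rw [Set.encard_eq_three.2 ⟨x, y, z, hxy.ne, (hxy.trans hyz).ne, hyz.ne, rfl⟩] at this
    norm_num at this
  have hbt : b ≠ t := by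
    rintro rfl
    obtain ⟨s, -⟩ := (IsChain.empty (r := (· ≤ ·)) (α := P)).exists_subset_flag
    have h1 : (s : Set P).encard ≤ 1 := Set.encard_le_one_iff.2 fun x y _ _ =>
      (le_antisymm ((ht x).trans (hb y)) ((ht y).trans (hb x)))
    rw [h.flag_card s] at h1
    norm_num at h1
  have htb : ¬ IsBot t := fun h => hbt (hb.eq h)
  refine ⟨⟨b, hb, if_pos hb⟩, ⟨t, ht, if_neg htb⟩, fun x y hxy => ?_, fun F G _ hr => ?_,
    fun F G _ hr => ?_, fun F G _ hr => ?_⟩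
  · have hx : IsBot x := by
      by_contra hx
      exact key b x y (hb.lt_of_not hx) hxy
    simp only [if_pos hx, if_neg (not_isBot_of_lt hxy), zero_lt_one]
  · have := hle G
    omega
  · have := hle G
    omega
  · have := hle G
    omega

theorem one_le_of_join_pt {Q R : Type*} [PartialOrder Q] [PartialOrder R] (hQ : IsPolytope n Q)
    (hn : 2 ≤ n) (hR : IsPolytope m R) (e : Q ≃o Join R Pt) : 1 ≤ m := by
  by_contra hm
  obtain rfl : m = 0 := by omega
  have := (hR.isGraded_zero.joinPt.of_orderIso e).isPolytope.rank_unique hQ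
  omega

theorem one_le_of_cartProd_edge {Q R : Type*} [PartialOrder Q] [PartialOrder R]
    (hQ : IsPolytope n Q) (hn : 2 ≤ n) (hR : IsPolytope m R) (e : Q ≃o CartProd R Edge) :
    1 ≤ m := by
  by_contra hm
  obtain rfl : m = 0 := by omega
  have := (hR.isGraded_zero.timesEdge.of_orderIso e).isPolytope.rank_unique hQ
  omega

end IsPolytope

/-! ## The constructed polytopes are polytopes -/

/-- The edge is the join of its two vertices. -/
def edgeIso : Edge ≃o Join Pt Pt where
  toFun s := (decide ((0 : ZMod 2) ∈ s), decide ((1 : ZMod 2) ∈ s))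
  invFun x := Finset.univ.filter fun z : ZMod 2 => (z = 0 ∧ x.1 = true) ∨ (z = 1 ∧ x.2 = true)
  left_inv s := by revert s; decide
  right_inv x := by revert x; decide
  map_rel_iff' {s t} := by
    change (decide ((0 : ZMod 2) ∈ s) ≤ decide ((0 : ZMod 2) ∈ t) ∧
      decide ((1 : ZMod 2) ∈ s) ≤ decide ((1 : ZMod 2) ∈ t)) ↔ s ⊆ t
    revert s t
    decide

namespace Construction

theorem exists_isGraded (w : Construction) : ∃ r : w.poly → ℕ, IsGraded w.dim w.poly r := by
  induction w with
  | edge => exact ⟨_, IsGraded.pt.joinPt.of_orderIso edgeIso⟩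
  | timesEdge w ih =>
    obtain ⟨r, hr⟩ := ih
    exact ⟨_, hr.timesEdge⟩
  | joinPt w ih =>
    obtain ⟨r, hr⟩ := ih
    exact ⟨_, hr.joinPt⟩

theorem isPolytope (w : Construction) : IsPolytope w.dim w.poly :=
  w.exists_isGraded.choose_spec.isPolytope

theorem one_le_dim (w : Construction) : 1 ≤ w.dim := by
  cases w <;> simp [dim]

end Construction

/-! ## Opposite facets -/

section Opposite

variable {P P' Q Q' : Type*} [PartialOrder P] [PartialOrder P'] [PartialOrder Q] [PartialOrder Q']

theorem isTop_orderIso_iff (e : P ≃o P') (x : P) : IsTop (e x) ↔ IsTop x := by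
  constructor
  · intro h y
    exact e.le_iff_le.1 (h (e y))
  · intro h y
    simpa using e.monotone (h (e.symm y))

/-- A facet: a face different from the least one and covered by the greatest one. -/
def IsFacet (c : P) : Prop := ¬ IsBot c ∧ ¬ IsTop c ∧ ∀ x, c ≤ x → x = c ∨ IsTop x

/-- Disjoint facets. -/
def Opposite (c d : P) : Prop := IsFacet c ∧ IsFacet d ∧ ∀ x, x ≤ c → x ≤ d → IsBot x

theorem IsFacet.map (e : P ≃o P') {c : P} (h : IsFacet c) : IsFacet (e c) := by
  refine ⟨by rw [isBot_orderIso_iff]; exact h.1, by rw [isTop_orderIso_iff]; exact h.2.1,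
    fun x hx => ?_⟩
  obtain ⟨x, rfl⟩ := e.surjective x
  rw [isTop_orderIso_iff, e.injective.eq_iff]
  exact h.2.2 x (e.le_iff_le.1 hx)

theorem Opposite.map (e : P ≃o P') {c d : P} (h : Opposite c d) : Opposite (e c) (e d) := by
  refine ⟨h.1.map e, h.2.1.map e, fun x hc hd => ?_⟩
  obtain ⟨x, rfl⟩ := e.surjective x
  rw [isBot_orderIso_iff]
  exact h.2.2 x (e.le_iff_le.1 hc) (e.le_iff_le.1 hd)

namespace CartProd

/-- Enlarging one coordinate of a facet to the top must give the facet itself or the greatest face.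
Hence exactly one coordinate is not the top, and it is a facet of its factor. -/
theorem isFacet_cases {p : P} {q : Q} (hp : ¬ IsBot p) (hq : ¬ IsBot q) (hpt : IsTop p)
    (hqt : IsTop q) {x : CartProd P Q} (hx : IsFacet x) :
    (∃ c, ∃ hc : IsFacet c, x = pair c q hc.1 hq) ∨
      ∃ d, ∃ hd : IsFacet d, x = pair p d hp hd.1 := by
  obtain ⟨hxb, hxt, hx⟩ := hx
  obtain ⟨c, d, hc, hd, rfl⟩ := exists_eq_pair hxb
  by_cases hct : IsTop c
  · have hdt : ¬ IsTop d := fun hdt => hxt (isTop_pair hct hdt)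
    obtain rfl : c = p := le_antisymm (hpt c) (hct p)
    refine Or.inr ⟨d, ⟨hd, hdt, fun y hy => ?_⟩, rfl⟩
    rcases hx (pair c y hc (not_isBot_of_le hy hd)) ⟨le_rfl, hy⟩ with h | h
    · exact Or.inl (pair_inj.1 h).2
    · exact Or.inr fun z => (hqt z).trans (h (pair c q hc hq)).2
  · obtain rfl : q = d := by
      rcases hx (pair c q hc hq) ⟨le_rfl, hqt d⟩ with h | h
      · exact (pair_inj.1 h).2
      · exact (hct fun z => (hpt z).trans (h (pair p q hp hq)).1).elim
    refine Or.inl ⟨c, ⟨hc, hct, fun y hy => ?_⟩, rfl⟩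
    rcases hx (pair y q (not_isBot_of_le hy hc) hd) ⟨hy, le_rfl⟩ with h | h
    · exact Or.inl (pair_inj.1 h).1
    · exact Or.inr fun z => (hpt z).trans (h (pair p q hp hq)).1

/-- Facets `(c, q)` and `(p, d)` from different factors are never opposite, since `(c, d)` lies
below both and is not the least face. -/
theorem opposite_cases {p : P} {q : Q} (hp : ¬ IsBot p) (hq : ¬ IsBot q) (hpt : IsTop p)
    (hqt : IsTop q) {x y : CartProd P Q} (h : Opposite x y) :
    (∃ c d, ∃ h : Opposite c d, x = pair c q h.1.1 hq ∧ y = pair d q h.2.1.1 hq) ∨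
      ∃ c d, ∃ h : Opposite c d, x = pair p c hp h.1.1 ∧ y = pair p d hp h.2.1.1 := by
  obtain ⟨hx, hy, hxy⟩ := h
  rcases isFacet_cases hp hq hpt hqt hx with ⟨c, hc, rfl⟩ | ⟨c, hc, rfl⟩ <;>
    rcases isFacet_cases hp hq hpt hqt hy with ⟨d, hd, rfl⟩ | ⟨d, hd, rfl⟩
  · refine Or.inl ⟨c, d, ⟨hc, hd, fun z hzc hzd => ?_⟩, rfl, rfl⟩
    by_contra hz
    exact not_isBot_pair (hxy (pair z q hz hq) ⟨hzc, le_rfl⟩ ⟨hzd, le_rfl⟩)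
  · exact (not_isBot_pair (hxy (pair c d hc.1 hd.1) ⟨le_rfl, hqt d⟩ ⟨hpt c, le_rfl⟩)).elim
  · exact (not_isBot_pair (hxy (pair d c hd.1 hc.1) ⟨hpt d, le_rfl⟩ ⟨le_rfl, hqt c⟩)).elim
  · refine Or.inr ⟨c, d, ⟨hc, hd, fun z hzc hzd => ?_⟩, rfl, rfl⟩
    by_contra hz
    exact not_isBot_pair (hxy (pair p z hp hz) ⟨le_rfl, hzc⟩ ⟨le_rfl, hzd⟩)

theorem isFacet_pair_top {p : P} (hp : ¬ IsBot p) (hpt : IsTop p) {c : Q} (hc : IsFacet c) :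
    IsFacet (pair p c hp hc.1) := by
  refine ⟨not_isBot_pair, fun h => hc.2.1 fun z => ?_, fun x hx => ?_⟩
  · by_cases hz : IsBot z
    · exact hz c
    · exact (h (pair p z hp hz)).2
  · obtain ⟨y, d, hy, hd, rfl⟩ := exists_eq_pair (not_isBot_of_le hx not_isBot_pair)
    obtain rfl : y = p := le_antisymm (hpt y) hx.1
    exact (hc.2.2 d hx.2).imp (fun h => pair_inj.2 ⟨rfl, h⟩) fun h => isTop_pair hpt h

theorem opposite_pair_top {p : P} (hp : ¬ IsBot p) (hpt : IsTop p) {c d : Q}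
    (h : Opposite c d) : Opposite (pair p c hp h.1.1) (pair p d hp h.2.1.1) := by
  refine ⟨isFacet_pair_top hp hpt h.1, isFacet_pair_top hp hpt h.2.1, fun x hc hd => ?_⟩
  rw [← isBot_snd_iff]
  exact h.2.2 _ hc.2 hd.2

/-- An automorphism of a Cartesian product that preserves the second coordinate acts on the
first factor only. -/
theorem exists_eq_congr_refl {q : Q} (hq : ¬ IsBot q) (hqt : IsTop q)
    (f : Aut (CartProd P Q)) (hf : ∀ x, (f x).1.2 = x.1.2) :
    ∃ g : Aut P, f = congr g (OrderIso.refl Q) := by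
  have hfs : ∀ x, (f.symm x).1.2 = x.1.2 := fun x => by
    rw [← hf, OrderIso.apply_symm_apply]
  have key : ∀ (e : Aut (CartProd P Q)), (∀ x, (e x).1.2 = x.1.2) →
      ∀ p q (hp : ¬ IsBot p) (hq : ¬ IsBot q), ∃ p' hp', e (pair p q hp hq) = pair p' q hp' hq := by
    intro e he p q hp hq
    obtain ⟨p', q', hp', hq', h⟩ := exists_eq_pair
      (x := e (pair p q hp hq)) (by rw [isBot_orderIso_iff]; exact not_isBot_pair)
    obtain rfl : q' = q := by
      have := he (pair p q hp hq)
      rwa [h] at this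
    exact ⟨p', hp', h⟩
  -- The action on the slice over the greatest face `q` gives the candidate for the automorphism of
  -- `P`; the least face of `P`, absent from that slice, is fixed by convention.
  have base : ∀ (e : Aut (CartProd P Q)), (∀ x, (e x).1.2 = x.1.2) →
      ∃ G : P → P, Monotone G ∧ (∀ x, IsBot x → G x = x) ∧
        ∀ p (hp : ¬ IsBot p), ∃ hp', e (pair p q hp hq) = pair (G p) q hp' hq := by
    intro e he
    have : ∀ p, ∃ p', (IsBot p → p' = p) ∧
        ∀ hp : ¬ IsBot p, ∃ hp', e (pair p q hp hq) = pair p' q hp' hq := by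
      intro p
      by_cases hp : IsBot p
      · exact ⟨p, fun _ => rfl, fun h => (h hp).elim⟩
      · obtain ⟨p', hp', h⟩ := key e he p q hp hq
        exact ⟨p', fun h => (hp h).elim, fun _ => ⟨hp', h⟩⟩
    choose G hG hG' using this
    refine ⟨G, fun x y hxy => ?_, hG, hG'⟩
    by_cases hx : IsBot x
    · rw [hG x hx]
      exact hx _
    · obtain ⟨h1, h1'⟩ := hG' x hx
      obtain ⟨h2, h2'⟩ := hG' y (not_isBot_of_le hxy hx)
      have := e.monotone (show pair x q hx hq ≤ pair y q (not_isBot_of_le hxy hx) hq from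
        ⟨hxy, le_rfl⟩)
      rw [h1', h2'] at this
      exact this.1
  obtain ⟨G, hG, hGb, hGp⟩ := base f hf
  obtain ⟨H, hH, hHb, hHp⟩ := base f.symm hfs
  have hHG : ∀ x, H (G x) = x := fun x => by
    by_cases hx : IsBot x
    · rw [hGb x hx, hHb x hx]
    · obtain ⟨h1, h1'⟩ := hGp x hx
      obtain ⟨h2, h2'⟩ := hHp _ h1
      rw [← h1', OrderIso.symm_apply_apply] at h2'
      exact (pair_inj.1 h2').1.symm
  have hGH : ∀ x, G (H x) = x := fun x => by
    by_cases hx : IsBot x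
    · rw [hHb x hx, hGb x hx]
    · obtain ⟨h1, h1'⟩ := hHp x hx
      obtain ⟨h2, h2'⟩ := hGp _ h1
      rw [← h1', OrderIso.apply_symm_apply] at h2'
      exact (pair_inj.1 h2').1.symm
  refine ⟨(Equiv.mk G H hHG hGH).toOrderIso hG hH, RelIso.ext fun x => ?_⟩
  rcases x.cases with hx | ⟨p, s, hp, hs, rfl⟩
  · exact IsBot.eq ((isBot_orderIso_iff _ _).2 hx) ((isBot_orderIso_iff _ _).2 hx)
  · obtain ⟨p', hp', h⟩ := key f hf p s hp hs
    obtain ⟨h1, h1'⟩ := hGp p hp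
    -- Comparing `(p, s)` with `(p, q)` gives `p' ≤ G p`. The converse comes from pulling `(G p, s)`
    -- back by `f`: its preimage `(p₂, s)` has `p₂ ≤ p`, and applying `f` again yields `G p ≤ p'`.
    obtain ⟨p₂, hp₂, h2⟩ := key f.symm hfs (G p) s h1 hs
    have hle : p' ≤ G p := by
      have := f.monotone (show pair p s hp hs ≤ pair p q hp hq from ⟨le_rfl, hqt s⟩)
      rw [h, h1'] at this
      exact this.1
    have hle₂ : p₂ ≤ p := by
      have := f.symm.monotone (show pair (G p) s h1 hs ≤ pair (G p) q h1 hq from ⟨le_rfl, hqt s⟩)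
      rw [h2, ← h1', OrderIso.symm_apply_apply] at this
      exact this.1
    have hge : G p ≤ p' := by
      have := f.monotone (show pair p₂ s hp₂ hs ≤ pair p s hp hs from ⟨hle₂, le_rfl⟩)
      rw [← h2, OrderIso.apply_symm_apply, h] at this
      exact this.1
    rw [h]
    exact Subtype.ext (Prod.ext (le_antisymm hle hge) rfl)

theorem congr_pair (g : P ≃o P') (h : Q ≃o Q') {p : P} {q : Q} {hp : ¬ IsBot p} {hq : ¬ IsBot q} :
    congr g h (pair p q hp hq) = pair (g p) (h q) (by rwa [isBot_orderIso_iff])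
      (by rwa [isBot_orderIso_iff]) :=
  rfl

/-- The automorphisms of a Cartesian product that act on both factors separately. -/
def congrHom (P Q : Type*) [PartialOrder P] [PartialOrder Q] :
    Aut P × Aut Q →* Aut (CartProd P Q) where
  toFun e := congr e.1 e.2
  map_one' := rfl
  map_mul' _ _ := rfl

theorem congrHom_injective {p : P} {q : Q} (hp : ¬ IsBot p) (hq : ¬ IsBot q) :
    Function.Injective (congrHom P Q) := by
  refine (injective_iff_map_eq_one _).2 fun e he => Prod.ext (RelIso.ext fun x => ?_)
    (RelIso.ext fun x => ?_)
  · by_cases hx : IsBot x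
    · exact IsBot.eq ((isBot_orderIso_iff _ _).2 hx) hx
    · exact congrArg (fun y => y.1.1) (DFunLike.congr_fun he (pair x q hx hq))
  · by_cases hx : IsBot x
    · exact IsBot.eq ((isBot_orderIso_iff _ _).2 hx) hx
    · exact congrArg (fun y => y.1.2) (DFunLike.congr_fun he (pair p x hp hx))

end CartProd

end Opposite

/-! ## Opposite facets of edges and cubes -/

theorem isTop_univ_edge : IsTop (Finset.univ : Edge) := fun s => Finset.subset_univ s

theorem isTop_edge_iff {s : Edge} : IsTop s ↔ s = Finset.univ :=
  ⟨fun h => le_antisymm (Finset.subset_univ s) (h _), fun h => h ▸ isTop_univ_edge⟩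

theorem isFacet_edge_iff {s : Edge} : IsFacet s ↔ ∃ z, s = {z} := by
  constructor
  · intro h
    refine (edge_cases_of_not_isBot h.1).resolve_right fun h' => h.2.1 (isTop_edge_iff.2 h')
  · rintro ⟨z, rfl⟩
    refine ⟨not_isBot_singleton z, fun h => (singleton_lt_univ z).ne (isTop_edge_iff.1 h),
      fun x hx => ?_⟩
    rw [isTop_edge_iff]
    exact hx.eq_or_lt.imp Eq.symm fun h => (edge_cases_of_lt (not_isBot_singleton z) h).2

theorem opposite_edge_iff {s t : Edge} : Opposite s t ↔ ∃ z, s = {z} ∧ t = {z + 1} := by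
  simp only [Opposite, isFacet_edge_iff, isBot_edge_iff]
  revert s t
  decide

namespace CartPow

variable {k : ℕ}

theorem isBot_iff_apply {P : Type*} [PartialOrder P] (x : CartPow P k) (i : Fin k) :
    IsBot x ↔ IsBot (x.1 i) := by
  cases k with
  | zero => exact i.elim0
  | succ k =>
    rw [isBot_iff]
    exact x.2.elim (fun h => iff_of_false (h 0) (h i)) fun h => iff_of_true (h 0) (h i)

theorem ext {P : Type*} [PartialOrder P] {x y : CartPow P k} (h : ∀ i, x.1 i = y.1 i) : x = y :=
  Subtype.ext (funext h)

/-- The greatest face of a cube. -/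
def top (k : ℕ) : CartPow Edge k := ⟨fun _ => Finset.univ, Or.inl fun _ => not_isBot_univ⟩

theorem isTop_top : IsTop (top k) := fun _ _ => Finset.subset_univ _

theorem not_isBot_top (hk : 1 ≤ k) : ¬ IsBot (top k) := by
  rw [isBot_iff_apply _ ⟨0, hk⟩]
  exact not_isBot_univ

/-- The facet of a cube on which the `i`-th coordinate is `z`. -/
def facet (i : Fin k) (z : ZMod 2) : CartPow Edge k :=
  ⟨fun j => if j = i then {z} else Finset.univ, Or.inl fun j => by
    dsimp only
    split_ifs
    exacts [not_isBot_singleton z, not_isBot_univ]⟩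

theorem facet_apply_self (i : Fin k) (z : ZMod 2) : (facet i z).1 i = {z} := if_pos rfl

theorem facet_apply_of_ne {i j : Fin k} (h : j ≠ i) (z : ZMod 2) :
    (facet i z).1 j = Finset.univ := if_neg h

theorem le_facet_iff {x : CartPow Edge k} {i : Fin k} {z : ZMod 2} :
    x ≤ facet i z ↔ x.1 i ≤ {z} := by
  constructor
  · intro h
    have := h i
    rwa [facet_apply_self] at this
  · intro h j
    by_cases hj : j = i
    · subst hj
      rwa [facet_apply_self]
    · rw [facet_apply_of_ne hj]
      exact Finset.subset_univ _

theorem facet_inj {i j : Fin k} {z y : ZMod 2} (h : facet i z = facet j y) : i = j ∧ z = y := by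
  have h1 := le_facet_iff.1 h.le
  by_cases hij : i = j
  · subst hij
    rw [facet_apply_self] at h1
    exact ⟨rfl, Finset.singleton_subset_singleton.1 h1⟩
  · rw [facet_apply_of_ne (Ne.symm hij)] at h1
    exact absurd h1 (singleton_lt_univ y).not_ge

theorem isFacet_facet (i : Fin k) (z : ZMod 2) : IsFacet (facet i z) := by
  refine ⟨?_, fun h => ?_, fun x hx => ?_⟩
  · rw [isBot_iff_apply _ i, facet_apply_self]
    exact not_isBot_singleton z
  · have := h (top k) i
    rw [facet_apply_self] at this
    exact absurd this (singleton_lt_univ z).not_ge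
  · have huniv : ∀ j, j ≠ i → x.1 j = Finset.univ := fun j hj => by
      have := hx j
      rw [facet_apply_of_ne hj] at this
      exact le_antisymm (Finset.subset_univ _) this
    have hxi := hx i
    rw [facet_apply_self] at hxi
    rcases (isFacet_edge_iff.2 ⟨z, rfl⟩).2.2 _ hxi with h | h
    · refine Or.inl (ext fun j => ?_)
      by_cases hj : j = i
      · subst hj
        rw [h, facet_apply_self]
      · rw [huniv j hj, facet_apply_of_ne hj]
    · right
      intro y j
      by_cases hj : j = i
      · subst hj
        exact h _
      · rw [huniv j hj]
        exact Finset.subset_univ _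

theorem exists_eq_facet {x : CartPow Edge k} (hx : IsFacet x) : ∃ i z, x = facet i z := by
  obtain ⟨i, hi⟩ : ∃ i, x.1 i ≠ Finset.univ := by
    by_contra! h
    exact hx.2.1 fun y i => (h i).symm ▸ Finset.subset_univ _
  have hib : ¬ IsBot (x.1 i) := by
    rw [← isBot_iff_apply]
    exact hx.1
  obtain ⟨z, hz⟩ := (edge_cases_of_not_isBot hib).resolve_right hi
  refine ⟨i, z, ?_⟩
  rcases hx.2.2 _ (le_facet_iff.2 hz.le) with h | h
  · exact h.symm
  · exact ((isFacet_facet i z).2.1 h).elim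

theorem opposite_facet (i : Fin k) (z : ZMod 2) : Opposite (facet i z) (facet i (z + 1)) := by
  refine ⟨isFacet_facet i z, isFacet_facet i _, fun x h1 h2 => ?_⟩
  rw [isBot_iff_apply _ i]
  exact (opposite_edge_iff.2 ⟨z, rfl, rfl⟩).2.2 _ (le_facet_iff.1 h1) (le_facet_iff.1 h2)

/-- Facets of a cube belonging to different coordinates have a common vertex, and a facet is not
opposite to itself. -/
theorem exists_of_opposite {x y : CartPow Edge k} (h : Opposite x y) :
    ∃ i z, x = facet i z ∧ y = facet i (z + 1) := by
  obtain ⟨i, z, rfl⟩ := exists_eq_facet h.1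
  obtain ⟨j, y, rfl⟩ := exists_eq_facet h.2.1
  have key : ∀ w : CartPow Edge k, (∀ l, ¬ IsBot (w.1 l)) → w ≤ facet i z → w ≤ facet j y → False :=
    fun w hw h1 h2 => hw i ((isBot_iff_apply _ _).1 (h.2.2 w h1 h2))
  obtain rfl : i = j := by
    by_contra hij
    -- A vertex on both facets: the `i`-th coordinate is `z`, all others (in particular the `j`-th)
    -- are `y`.
    refine key ⟨fun l => if l = i then {z} else {y}, Or.inl fun l => ?_⟩ (fun l => ?_)
      (le_facet_iff.2 ?_) (le_facet_iff.2 ?_)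
    · dsimp only
      split_ifs <;> exact not_isBot_singleton _
    · dsimp only
      split_ifs <;> exact not_isBot_singleton _
    · exact (if_pos rfl).le
    · exact (if_neg (Ne.symm hij)).le
  refine ⟨i, z, rfl, ?_⟩
  have hyz : y ≠ z := by
    rintro rfl
    exact h.1.1 (h.2.2 _ le_rfl le_rfl)
  have : ∀ y z : ZMod 2, y ≠ z → y = z + 1 := by decide
  rw [this y z hyz]

end CartPow

/-! ## Automorphisms of edges and cubes -/

/-- The translations of the edge. -/
def edgeAdd (z : ZMod 2) : Aut Edge where
  toEquiv := (Equiv.addRight z).finsetCongr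
  map_rel_iff' {s t} := by simp [Equiv.finsetCongr_apply]

theorem edgeAdd_one : edgeAdd 1 = edgeFlip := rfl

theorem edgeAdd_singleton (z y : ZMod 2) : edgeAdd z {y} = {y + z} := by
  revert z y
  decide

theorem edgeAdd_zero (s : Edge) : edgeAdd 0 s = s := by
  revert s
  decide

theorem edgeAdd_add (y z : ZMod 2) (s : Edge) : edgeAdd (y + z) s = edgeAdd y (edgeAdd z s) := by
  revert y z s
  decide

theorem edgeAdd_univ (z : ZMod 2) : edgeAdd z Finset.univ = Finset.univ := by
  revert z
  decide

namespace CartPow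

variable {k : ℕ}

/-- The action of a signed permutation on the faces of the cube. -/
def actFun (w : SignedPerm k) (x : CartPow Edge k) : CartPow Edge k :=
  ⟨fun i => edgeAdd (w.left i).toAdd (x.1 (w.right⁻¹ i)),
    x.2.imp (fun h i => by rw [isBot_orderIso_iff]; exact h _)
      (fun h i => by rw [isBot_orderIso_iff]; exact h _)⟩

theorem actFun_mono (w : SignedPerm k) : Monotone (actFun w) :=
  fun _ _ h _ => OrderIso.monotone _ (h _)

theorem actFun_one (x : CartPow Edge k) : actFun 1 x = x :=
  ext fun _ => edgeAdd_zero _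

theorem actFun_mul (w w' : SignedPerm k) (x : CartPow Edge k) :
    actFun (w * w') x = actFun w (actFun w' x) :=
  ext fun _ => edgeAdd_add _ _ _

/-- Signed permutations act on the cube by automorphisms. -/
def act (k : ℕ) : SignedPerm k →* Aut (CartPow Edge k) where
  toFun w := (Equiv.mk (actFun w) (actFun w⁻¹)
    (fun x => by rw [← actFun_mul, inv_mul_cancel, actFun_one])
    (fun x => by rw [← actFun_mul, mul_inv_cancel, actFun_one])).toOrderIso
      (actFun_mono w) (actFun_mono w⁻¹)
  map_one' := RelIso.ext actFun_one
  map_mul' w w' := RelIso.ext (actFun_mul w w')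

theorem act_apply (w : SignedPerm k) (x : CartPow Edge k) (i : Fin k) :
    (act k w x).1 i = edgeAdd (w.left i).toAdd (x.1 (w.right⁻¹ i)) := rfl

theorem act_facet (w : SignedPerm k) (i : Fin k) (z : ZMod 2) :
    act k w (facet i z) = facet (w.right i) (z + (w.left (w.right i)).toAdd) := by
  refine ext fun j => ?_
  rw [act_apply]
  by_cases hj : j = w.right i
  · subst hj
    rw [facet_apply_self, show w.right⁻¹ (w.right i) = i from w.right.symm_apply_apply i,
      facet_apply_self, edgeAdd_singleton]
  · rw [facet_apply_of_ne hj, facet_apply_of_ne, edgeAdd_univ]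
    rintro rfl
    exact hj (w.right.apply_symm_apply j).symm

/-- The images of the facets `facet i 0` show both the permutation and the signs. -/
theorem act_injective : Function.Injective (act k) := by
  refine (injective_iff_map_eq_one _).2 fun w hw => ?_
  have h : ∀ i, w.right i = i ∧ (w.left (w.right i)).toAdd = 0 := fun i => by
    have := act_facet w i 0
    rw [hw, zero_add] at this
    exact (facet_inj this).imp Eq.symm Eq.symm
  have hr : w.right = 1 := Equiv.ext fun i => (h i).1
  refine SemidirectProduct.ext (funext fun i => ?_) hr
  have := (h i).2
  rw [(h i).1] at this
  exact this

end CartPow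

/-! ## Automorphisms of Cartesian products with cubes -/

section Facets

variable {P Q : Type*} [PartialOrder P] [PartialOrder Q]

/-- Every face is determined by the facets that contain it. -/
def DeterminedByFacets (Q : Type*) [PartialOrder Q] : Prop :=
  ∀ x y : Q, (∀ d, IsFacet d → (x ≤ d ↔ y ≤ d)) → x = y

theorem determinedByFacets_edge : DeterminedByFacets Edge := by
  intro x y h
  have h' : ∀ z : ZMod 2, x ≤ {z} ↔ y ≤ {z} := fun z => h _ (isFacet_edge_iff.2 ⟨z, rfl⟩)
  clear h
  revert x y
  decide

theorem determinedByFacets_cube (k : ℕ) : DeterminedByFacets (CartPow Edge k) := by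
  refine fun x y h => CartPow.ext fun i => determinedByFacets_edge _ _ fun d hd => ?_
  obtain ⟨z, rfl⟩ := isFacet_edge_iff.1 hd
  rw [← CartPow.le_facet_iff, ← CartPow.le_facet_iff]
  exact h _ (CartPow.isFacet_facet i z)

/-- The second coordinate of a face is known from the facets `(p, d)` that contain it. As `f` fixes
these facets, it preserves the second coordinate. -/
theorem CartProd.exists_eq_congr_of_facets (hQ : DeterminedByFacets Q) {p : P} {q : Q}
    (hp : ¬ IsBot p) (hq : ¬ IsBot q) (hpt : IsTop p) (hqt : IsTop q) (f : Aut (CartProd P Q))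
    (hf : ∀ d (hd : IsFacet d), f (pair p d hp hd.1) = pair p d hp hd.1) :
    ∃ g : Aut P, f = congr g (OrderIso.refl Q) := by
  refine exists_eq_congr_refl hq hqt f fun x => hQ _ _ fun d hd => ?_
  have key : ∀ x : CartProd P Q, x.1.2 ≤ d ↔ x ≤ pair p d hp hd.1 :=
    fun x => ⟨fun h => ⟨hpt _, h⟩, fun h => h.2⟩
  rw [key, key, ← hf d hd, f.le_iff_le, hf d hd]

/-- An automorphism of `P × I` that preserves the pair of the two copies of `P`. -/
theorem CartProd.exists_eq_congr_edgeAdd {p : P} (hp : ¬ IsBot p) (hpt : IsTop p)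
    (f : Aut (CartProd P Edge)) (a : ZMod 2)
    (hf : ∀ z, f (pair p {z} hp (not_isBot_singleton z)) =
      pair p {z + a} hp (not_isBot_singleton _)) :
    ∃ g : Aut P, f = congr g (edgeAdd a) := by
  obtain ⟨g, hg⟩ := exists_eq_congr_of_facets determinedByFacets_edge hp not_isBot_univ hpt
    isTop_univ_edge ((congr (OrderIso.refl P) (edgeAdd a))⁻¹ * f) (fun d hd => by
      obtain ⟨z, rfl⟩ := isFacet_edge_iff.1 hd
      rw [RelIso.mul_apply, hf]
      refine (congrArg _ ?_).trans (RelIso.inv_apply_self _ _)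
      rw [congr_pair]
      exact pair_inj.2 ⟨rfl, (edgeAdd_singleton a z).symm⟩)
  refine ⟨g, ?_⟩
  rw [inv_mul_eq_iff_eq_mul] at hg
  exact hg

/-- Without opposite facets in `P`, the only opposite pairs are the `k` pairs of the cube. The
automorphism permutes them, possibly exchanging the members of a pair; undoing this signed
permutation leaves all facets coming from the cube fixed. -/
theorem CartProd.exists_eq_congr_act {k : ℕ} (hk : 1 ≤ k) {p : P} (hp : ¬ IsBot p)
    (hpt : IsTop p) (hP : ∀ c d : P, ¬ Opposite c d) (f : Aut (CartProd P (CartPow Edge k))) :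
    ∃ g w, f = congr g (CartPow.act k w) := by
  let F : Fin k → ZMod 2 → CartProd P (CartPow Edge k) := fun i z =>
    pair p (CartPow.facet i z) hp (CartPow.isFacet_facet i z).1
  have hF : ∀ {i j z y}, F i z = F j y → i = j ∧ z = y := fun h =>
    CartPow.facet_inj (pair_inj.1 h).2
  have h1 : ∀ i, ∃ j a, f (F i 0) = F j a ∧ f (F i 1) = F j (a + 1) := fun i => by
    have hopp := (opposite_pair_top hp hpt (CartPow.opposite_facet i 0)).map f
    rcases opposite_cases hp (CartPow.not_isBot_top hk) hpt CartPow.isTop_top hopp with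
      ⟨c, d, h, -⟩ | ⟨c, d, h, hc, hd⟩
    · exact (hP c d h).elim
    · obtain ⟨j, a, rfl, rfl⟩ := CartPow.exists_of_opposite h
      exact ⟨j, a, hc, hd⟩
  choose σ a h0 h1 using h1
  have h2 : ∀ i z, f (F i z) = F (σ i) (z + a i) := fun i z => by
    rcases (show ∀ z : ZMod 2, z = 0 ∨ z = 1 by decide) z with rfl | rfl
    · rw [h0, zero_add]
    · rw [h1, add_comm]
  -- In characteristic 2 both `F i (a i)` and `F j (a j)` are sent to the facet with value 0 in the
  -- common image coordinate.
  have hσ : Function.Injective σ := fun i j hij => by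
    have : F i (a i) = F j (a j) := f.injective (by
      rw [h2, h2, hij, CharTwo.add_self_eq_zero, CharTwo.add_self_eq_zero])
    exact (hF this).1
  let e : Equiv.Perm (Fin k) := Equiv.ofBijective σ (Finite.injective_iff_bijective.1 hσ)
  -- The shifts `a` are indexed by the source coordinate, the signs of `w` by the target coordinate.
  let w : SignedPerm k := ⟨fun i => Multiplicative.ofAdd (a (e.symm i)), e⟩
  have hw : ∀ i z, congr (OrderIso.refl P) (CartPow.act k w) (F i z) = F (σ i) (z + a i) :=
    fun i z => by
      refine Subtype.ext (Prod.ext rfl ((CartPow.act_facet w i z).trans ?_))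
      change CartPow.facet (e i) (z + a (e.symm (e i))) = _
      rw [Equiv.symm_apply_apply]
      rfl
  obtain ⟨g, hg⟩ := exists_eq_congr_of_facets (determinedByFacets_cube k) hp
    (CartPow.not_isBot_top hk) hpt CartPow.isTop_top
    ((congr (OrderIso.refl P) (CartPow.act k w))⁻¹ * f) (fun d hd => by
      obtain ⟨i, z, rfl⟩ := CartPow.exists_eq_facet hd
      have := (h2 i z).trans (hw i z).symm
      rw [RelIso.mul_apply]
      exact (congrArg _ this).trans (RelIso.inv_apply_self _ _))
  refine ⟨g, w, ?_⟩
  rw [inv_mul_eq_iff_eq_mul] at hg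
  exact hg

/-- The automorphism group of the product of `P` with a cube. -/
theorem CartProd.nonempty_mulEquiv {k : ℕ} (hk : 1 ≤ k) {p : P} (hp : ¬ IsBot p)
    (hpt : IsTop p) (hP : ∀ c d : P, ¬ Opposite c d) :
    Nonempty (Aut (CartProd P (CartPow Edge k)) ≃* Aut P × SignedPerm k) := by
  let φ := (congrHom P (CartPow Edge k)).comp ((MonoidHom.id (Aut P)).prodMap (CartPow.act k))
  refine ⟨(MulEquiv.ofBijective φ ⟨?_, fun f => ?_⟩).symm⟩
  · exact (congrHom_injective hp (CartPow.not_isBot_top hk)).comp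
      (Function.injective_id.prodMap CartPow.act_injective)
  · obtain ⟨g, w, rfl⟩ := exists_eq_congr_act hk hp hpt hP f
    exact ⟨(g, w), rfl⟩

end Facets

/-! ### Polytopes without opposite facets -/

theorem not_opposite_pt (c d : Pt) : ¬ Opposite c d := fun h => by
  have h1 := h.1.1
  have h2 := h.1.2.1
  cases c
  · exact h1 fun x => Bool.false_le x
  · exact h2 fun x => Bool.le_true x

/-- The point has no facets at all, so the result on products applies to `pt × I^{×k}`, from which
the cube automorphism is read off. -/
theorem CartPow.act_surjective {k : ℕ} (hk : 1 ≤ k) : Function.Surjective (act k) := fun f => by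
  have ht : ¬ IsBot (true : Pt) := fun h => absurd (h false) (by decide)
  obtain ⟨g, w, h⟩ := CartProd.exists_eq_congr_act hk ht (fun x => Bool.le_true x)
    not_opposite_pt (CartProd.congr (OrderIso.refl Pt) f)
  have := CartProd.congrHom_injective ht (CartPow.not_isBot_top hk)
    (a₁ := (1, f)) (a₂ := (g, act k w)) h
  exact ⟨w, (Prod.ext_iff.1 this).2.symm⟩

/-- Conjugation by an isomorphism. -/
theorem nonempty_aut_mulEquiv {P Q : Type*} [PartialOrder P] [PartialOrder Q] (e : P ≃o Q) :
    Nonempty (Aut P ≃* Aut Q) :=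
  ⟨{ toFun := fun f => (e.symm.trans f).trans e
     invFun := fun f => (e.trans f).trans e.symm
     left_inv := fun f => RelIso.ext fun x => by simp
     right_inv := fun f => RelIso.ext fun x => by simp
     map_mul' := fun f g => RelIso.ext fun x => by simp }⟩

/-- A pyramid over a polytope of positive rank has no opposite facets. -/
theorem not_opposite_join_pt {n : ℕ} {R : Type*} [PartialOrder R] (hR : IsPolytope n R)
    (hn : 1 ≤ n) (c d : Join R Pt) : ¬ Opposite c d := by
  obtain ⟨b, hb⟩ := hR.exists_bot
  obtain ⟨t, ht⟩ := hR.exists_top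
  have hbt := hR.not_bot_covBy_top hn hb ht
  have htrue : ¬ IsBot (true : Pt) := fun h => absurd (h false) (by decide)
  have hfalse : IsBot (false : Pt) := fun x => Bool.false_le x
  have htop : IsTop (true : Pt) := fun x => Bool.le_true x
  have hfst : ∀ x : Join R Pt, IsBot x → IsBot x.1 := fun x hx y => (hx (y, x.2)).1
  have hsnd : ∀ x : Join R Pt, IsBot x → IsBot x.2 := fun x hx y => (hx (x.1, y)).2
  have hbase : ∀ x, IsFacet ((x, false) : Join R Pt) → x = t := fun x hx => by
    rcases hx.2.2 (t, false) ⟨ht x, le_rfl⟩ with h | h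
    · exact (congrArg Prod.fst h).symm
    · exact absurd (show (true : Bool) ≤ false from (h (t, true)).2) (by decide)
  -- If the apex itself were a facet, the greatest face of `R` would cover the least one, contrary
  -- to positive rank.
  have hside : ∀ x, IsFacet ((x, true) : Join R Pt) → ¬ IsBot x := fun x hx hxb => by
    refine hbt ⟨(hb t).lt_of_ne ?_, fun y hby hyt => ?_⟩
    · rintro rfl
      exact hx.2.1 fun y => ⟨(ht _).trans (hb _), htop _⟩
    · rcases hx.2.2 (y, true) ⟨hxb y, le_rfl⟩ with h | h
      · have hyx : y = x := congrArg Prod.fst h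
        exact hby.not_ge (hyx ▸ hxb b)
      · exact hyt.not_ge (h (t, true)).1
  -- The base is not opposite to itself, it meets a facet `(d, true)` in `(d, false)`, and two
  -- facets of the latter kind share the apex `(b, true)`.
  rintro ⟨hc, hd, hcd⟩
  obtain ⟨c, i⟩ := c
  obtain ⟨d, j⟩ := d
  cases i <;> cases j
  · obtain rfl := hbase c hc
    obtain rfl := hbase d hd
    exact hc.1 (hcd _ le_rfl le_rfl)
  · obtain rfl := hbase c hc
    exact hside d hd (hfst _ (hcd (d, false) ⟨ht d, le_rfl⟩ ⟨le_rfl, Bool.false_le _⟩))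
  · obtain rfl := hbase d hd
    exact hside c hc (hfst _ (hcd (c, false) ⟨le_rfl, Bool.false_le _⟩ ⟨ht c, le_rfl⟩))
  · exact htrue (hsnd _ (hcd (b, true) ⟨hb c, le_rfl⟩ ⟨hb d, le_rfl⟩))

/-- Rank at least 2 makes the base of positive rank. The edge is a pyramid over a point and does
have opposite facets. -/
theorem not_opposite_of_isPyramid {n : ℕ} (hn : 2 ≤ n) {Q : Type u} [PartialOrder Q]
    (hQ : IsPolytope n Q) (hpyr : IsPyramid Q) (c d : Q) : ¬ Opposite c d := by
  obtain ⟨R, _, m, hR, ⟨e⟩⟩ := hpyr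
  exact fun h => not_opposite_join_pt hR (hQ.one_le_of_join_pt hn hR e) _ _ (h.map e)

theorem IsPolytope.not_isBot_of_isTop {n : ℕ} (hn : 1 ≤ n) {P : Type*} [PartialOrder P]
    (h : IsPolytope n P) {t : P} (ht : IsTop t) : ¬ IsBot t := fun hb => by
  obtain ⟨x, h1, h2⟩ := h.exists_between hn hb ht
  exact lt_asymm h1 h2

theorem nonempty_aut_cube {P : Type*} [PartialOrder P] {k : ℕ} (hk : 1 ≤ k)
    (e : P ≃o CartPow Edge k) : Nonempty (Aut P ≃* SignedPerm k) := by
  obtain ⟨φ⟩ := nonempty_aut_mulEquiv e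
  exact ⟨φ.trans (MulEquiv.ofBijective (CartPow.act k)
    ⟨CartPow.act_injective, CartPow.act_surjective hk⟩).symm⟩

theorem nonempty_aut_cartProd_cube {P : Type*} {Q : Type u} [PartialOrder P] [PartialOrder Q]
    {n k : ℕ} (hn : 2 ≤ n) (hk : 1 ≤ k) (hQ : IsPolytope n Q) (hpyr : IsPyramid Q)
    (e : P ≃o CartProd Q (CartPow Edge k)) : Nonempty (Aut P ≃* Aut Q × SignedPerm k) := by
  obtain ⟨φ⟩ := nonempty_aut_mulEquiv e
  obtain ⟨t, ht⟩ := hQ.exists_top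
  obtain ⟨ψ⟩ := CartProd.nonempty_mulEquiv hk (hQ.not_isBot_of_isTop (by omega) ht) ht
    (not_opposite_of_isPyramid hn hQ hpyr)
  exact ⟨φ.trans ψ⟩

/-! ## Apices -/

section Apex

variable {P P' Q Q' : Type*} [PartialOrder P] [PartialOrder P'] [PartialOrder Q] [PartialOrder Q']

/-- A minimal face among those different from the least one. -/
def IsPoint (a : P) : Prop := ¬ IsBot a ∧ ∀ x, x ≤ a → x = a ∨ IsBot x

/-- A vertex that is joined to every other vertex by an edge. -/
def IsApex (a : P) : Prop := IsPoint a ∧ ∀ b, IsPoint b → b ≠ a → ∃ c, a ⋖ c ∧ b ⋖ c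

theorem IsPoint.map (e : P ≃o P') {a : P} (h : IsPoint a) : IsPoint (e a) := by
  refine ⟨by rw [isBot_orderIso_iff]; exact h.1, fun x hx => ?_⟩
  obtain ⟨x, rfl⟩ := e.surjective x
  rw [isBot_orderIso_iff, e.injective.eq_iff]
  exact h.2 x (e.le_iff_le.1 hx)

theorem IsApex.map (e : P ≃o P') {a : P} (h : IsApex a) : IsApex (e a) := by
  refine ⟨h.1.map e, fun b hb hne => ?_⟩
  have hb' := hb.map e.symm
  obtain ⟨b, rfl⟩ := e.surjective b
  rw [OrderIso.symm_apply_apply] at hb'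
  obtain ⟨c, h1, h2⟩ := h.2 b hb' fun hab => hne (congrArg e hab)
  exact ⟨e c, (apply_covBy_apply_iff e).2 h1, (apply_covBy_apply_iff e).2 h2⟩

theorem IsPoint.covBy {a b : P} (h : IsPoint a) (hb : IsBot b) : b ⋖ a :=
  ⟨hb.lt_of_not h.1, fun x hbx hxa => by
    rcases h.2 x hxa.le with rfl | hx
    · exact lt_irrefl _ hxa
    · exact not_isBot_of_lt hbx hx⟩

theorem isPoint_of_covBy {a b : P} (hb : IsBot b) (h : b ⋖ a) : IsPoint a :=
  ⟨not_isBot_of_lt h.1, fun x hx => by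
    rcases hx.eq_or_lt with rfl | hx
    · exact Or.inl rfl
    · right
      rcases (hb x).eq_or_lt with rfl | hbx
      · exact hb
      · exact (h.2 hbx hx).elim⟩

namespace Join

theorem isBot_mk {p : P} {q : Q} (hp : IsBot p) (hq : IsBot q) : IsBot ((p, q) : Join P Q) :=
  fun _ => ⟨hp _, hq _⟩

theorem isBot_fst {x : Join P Q} (h : IsBot x) : IsBot x.1 := fun y => (h (y, x.2)).1

theorem isBot_snd {x : Join P Q} (h : IsBot x) : IsBot x.2 := fun y => (h (x.1, y)).2

theorem isPoint_fst {q : Q} (hq : IsBot q) {a : P} :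
    IsPoint ((a, q) : Join P Q) ↔ IsPoint a := by
  constructor
  · refine fun h => ⟨fun ha => h.1 (isBot_mk ha hq), fun x hx => ?_⟩
    exact (h.2 (x, q) ⟨hx, le_rfl⟩).imp (congrArg Prod.fst) isBot_fst
  · refine fun h => ⟨fun ha => h.1 (isBot_fst ha), fun x hx => ?_⟩
    have hx2 : x.2 = q := le_antisymm hx.2 (hq _)
    exact (h.2 x.1 hx.1).imp (fun h => Prod.ext h hx2) fun h => isBot_mk h (hx2 ▸ hq)

theorem isPoint_snd {p : P} (hp : IsBot p) {b : Q} :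
    IsPoint ((p, b) : Join P Q) ↔ IsPoint b := by
  constructor
  · refine fun h => ⟨fun hb => h.1 (isBot_mk hp hb), fun x hx => ?_⟩
    exact (h.2 (p, x) ⟨le_rfl, hx⟩).imp (congrArg Prod.snd) isBot_snd
  · refine fun h => ⟨fun hb => h.1 (isBot_snd hb), fun x hx => ?_⟩
    have hx1 : x.1 = p := le_antisymm hx.1 (hp _)
    exact (h.2 x.2 hx.2).imp (fun h => Prod.ext hx1 h) fun h => isBot_mk (hx1 ▸ hp) h

theorem isPoint_cases {p : P} {q : Q} (hp : IsBot p) (hq : IsBot q) {x : Join P Q}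
    (h : IsPoint x) : (∃ a, IsPoint a ∧ x = (a, q)) ∨ ∃ b, IsPoint b ∧ x = (p, b) := by
  obtain ⟨a, b⟩ := x
  rcases h.2 (a, q) ⟨le_rfl, hq b⟩ with h' | h'
  · obtain rfl : q = b := congrArg Prod.snd h'
    exact Or.inl ⟨a, (isPoint_fst hq).1 h, rfl⟩
  · obtain rfl : a = p := (isBot_fst h').eq hp
    exact Or.inr ⟨b, (isPoint_snd hp).1 h, rfl⟩

/-- A covering changes only one coordinate, so a common cover of `(a, q)` and `(b, q)` with `a ≠ b`
must still have second coordinate `q`. -/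
theorem isApex_of_fst {q : Q} (hq : IsBot q) {a : P} (h : IsApex ((a, q) : Join P Q)) :
    IsApex a := by
  refine ⟨(isPoint_fst hq).1 h.1, fun b hb hne => ?_⟩
  obtain ⟨⟨c, d⟩, h1, h2⟩ := h.2 (b, q) ((isPoint_fst hq).2 hb) fun h => hne (congrArg Prod.fst h)
  rcases Prod.mk_covBy_mk_iff.1 h1 with ⟨h1, h1'⟩ | ⟨h1, h1'⟩ <;>
    rcases Prod.mk_covBy_mk_iff.1 h2 with ⟨h2, h2'⟩ | ⟨h2, h2'⟩
  · exact ⟨c, h1, h2⟩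
  · exact (h2.ne h1').elim
  · exact (h1.ne h2').elim
  · exact (hne (h2'.trans h1'.symm)).elim

theorem isApex_cases {p : P} {q : Q} (hp : IsBot p) (hq : IsBot q) {x : Join P Q}
    (h : IsApex x) : (∃ a, IsApex a ∧ x = (a, q)) ∨ ∃ b, IsPoint b ∧ x = (p, b) := by
  rcases isPoint_cases hp hq h.1 with ⟨a, -, rfl⟩ | h'
  · exact Or.inl ⟨a, isApex_of_fst hq h, rfl⟩
  · exact Or.inr h'

/-- In a join, the edge `(a, b)` connects a vertex `(a, q)` of the first factor with a vertex `(p,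
b)` of the second. -/
theorem isApex_snd {p : P} {q : Q} (hp : IsBot p) (hq : IsBot q) {b : Q} (h : IsApex b) :
    IsApex ((p, b) : Join P Q) := by
  refine ⟨(isPoint_snd hp).2 h.1, fun x hx hne => ?_⟩
  rcases isPoint_cases hp hq hx with ⟨a, ha, rfl⟩ | ⟨d, hd, rfl⟩
  · exact ⟨(a, b), Prod.mk_covBy_mk_iff.2 (Or.inl ⟨ha.covBy hp, rfl⟩),
      Prod.mk_covBy_mk_iff.2 (Or.inr ⟨h.1.covBy hq, rfl⟩)⟩
  · obtain ⟨c, h1, h2⟩ := h.2 d hd fun h => hne (congrArg _ h)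
    exact ⟨(p, c), Prod.mk_covBy_mk_iff.2 (Or.inr ⟨h1, rfl⟩),
      Prod.mk_covBy_mk_iff.2 (Or.inr ⟨h2, rfl⟩)⟩

/-- An automorphism of a join that preserves the second coordinate acts on the first factor
only. -/
theorem exists_eq_congr_refl {q : Q} (hq : IsBot q) (f : Aut (Join P Q))
    (hf : ∀ x, (f x).2 = x.2) : ∃ g : Aut P, f = congr g (OrderIso.refl Q) := by
  have hfs : ∀ x, (f.symm x).2 = x.2 := fun x => by rw [← hf, OrderIso.apply_symm_apply]
  have h1 : ∀ x, f (x, q) = ((f (x, q)).1, q) := fun x => Prod.ext rfl (hf _)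
  have h2 : ∀ x, f.symm (x, q) = ((f.symm (x, q)).1, q) := fun x => Prod.ext rfl (hfs _)
  let g : Aut P := (Equiv.mk (fun x => (f (x, q)).1) (fun x => (f.symm (x, q)).1)
    (fun x => by dsimp only; rw [← h1, OrderIso.symm_apply_apply])
    (fun x => by dsimp only; rw [← h2, OrderIso.apply_symm_apply])).toOrderIso
      (fun x y hxy => (f.monotone (show ((x, q) : Join P Q) ≤ (y, q) from ⟨hxy, le_rfl⟩)).1)
      (fun x y hxy => (f.symm.monotone (show ((x, q) : Join P Q) ≤ (y, q) from ⟨hxy, le_rfl⟩)).1)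
  refine ⟨g, RelIso.ext fun x => Prod.ext (le_antisymm ?_ ?_) (hf x)⟩
  -- One inequality comes from applying `f` to `(x.1, q) ≤ x`, the other from pulling `((f x).1, q)
  -- ≤ f x` back.
  · have h3 : ((g.symm (f x).1, q) : Join P Q) ≤ x := by
      have := f.symm.monotone (show (((f x).1, q) : Join P Q) ≤ f x from ⟨le_rfl, hq _⟩)
      rw [OrderIso.symm_apply_apply] at this
      exact ⟨this.1, hq _⟩
    exact g.symm_apply_le.1 h3.1
  · exact (f.monotone (show ((x.1, q) : Join P Q) ≤ x from ⟨le_rfl, hq _⟩)).1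

/-- The automorphisms of a join that act on both factors separately. -/
def congrHom (P Q : Type*) [PartialOrder P] [PartialOrder Q] :
    Aut P × Aut Q →* Aut (Join P Q) where
  toFun e := congr e.1 e.2
  map_one' := rfl
  map_mul' _ _ := rfl

theorem congrHom_injective (p : P) (q : Q) : Function.Injective (congrHom P Q) := by
  refine (injective_iff_map_eq_one _).2 fun e he => Prod.ext (RelIso.ext fun x => ?_)
    (RelIso.ext fun x => ?_)
  · exact congrArg Prod.fst (DFunLike.congr_fun he (x, q))
  · exact congrArg Prod.snd (DFunLike.congr_fun he (p, x))

/-- Every face is determined by its vertices. -/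
def DeterminedByPoints (Q : Type*) [PartialOrder Q] : Prop :=
  ∀ x y : Q, (∀ d, IsPoint d → (d ≤ x ↔ d ≤ y)) → x = y

theorem exists_eq_congr_of_points (hQ : DeterminedByPoints Q) {p : P} {q : Q}
    (hp : IsBot p) (hq : IsBot q) (f : Aut (Join P Q))
    (hf : ∀ d, IsPoint d → f (p, d) = (p, d)) : ∃ g : Aut P, f = congr g (OrderIso.refl Q) := by
  refine exists_eq_congr_refl hq f fun x => hQ _ _ fun d hd => ?_
  have key : ∀ x : Join P Q, d ≤ x.2 ↔ (p, d) ≤ x := fun x => ⟨fun h => ⟨hp _, h⟩, fun h => h.2⟩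
  rw [key, key, ← hf d hd, f.le_iff_le, hf d hd]

end Join

end Apex

/-! ## Automorphisms of simplices and of joins with simplices -/

theorem isBot_false : IsBot (false : Pt) := fun x => Bool.false_le x

theorem isPoint_pt_iff {b : Pt} : IsPoint b ↔ b = true := by
  constructor
  · intro h
    by_contra hb
    rw [Bool.not_eq_true] at hb
    exact h.1 (hb ▸ isBot_false)
  · rintro rfl
    refine ⟨fun h => absurd (h false) (by decide), fun x _ => ?_⟩
    cases x
    · exact Or.inr isBot_false
    · exact Or.inl rfl

theorem isApex_true : IsApex (true : Pt) :=
  ⟨isPoint_pt_iff.2 rfl, fun _ hb hne => (hne (isPoint_pt_iff.1 hb)).elim⟩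

theorem determinedByPoints_pt : Join.DeterminedByPoints Pt := by
  intro x y h
  have := h true (isPoint_pt_iff.2 rfl)
  clear h
  revert this
  revert x y
  decide

namespace JoinPow

variable {k : ℕ}

theorem isBot_bot : IsBot (fun _ => false : JoinPow Pt k) := fun _ _ => Bool.false_le _

theorem simplexVertex_le_iff {i : Fin k} {x : JoinPow Pt k} :
    simplexVertex i ≤ x ↔ x i = true := by
  constructor
  · intro h
    have := h i
    simpa [simplexVertex, Bool.le_iff_imp] using this
  · intro h j
    by_cases hj : j = i
    · subst hj
      rw [h]
      exact Bool.le_true _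
    · simp [simplexVertex, hj]

theorem simplexVertex_injective : Function.Injective (simplexVertex (k := k)) := fun i j h => by
  have := simplexVertex_le_iff.1 h.le
  simpa [simplexVertex] using this

theorem isPoint_simplexVertex (i : Fin k) : IsPoint (simplexVertex i) := by
  refine ⟨fun h => ?_, fun x hx => ?_⟩
  · have := simplexVertex_le_iff.1 (h fun _ => false)
    simp at this
  · by_cases hi : x i = true
    · exact Or.inl (le_antisymm hx (simplexVertex_le_iff.2 hi))
    · right
      have : x = fun _ => false := funext fun j => by
        by_cases hj : j = i
        · subst hj
          simpa using hi
        · exact le_antisymm ((hx j).trans (le_of_eq (decide_eq_false hj))) (Bool.false_le _)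
      rw [this]
      exact isBot_bot

theorem exists_eq_simplexVertex {x : JoinPow Pt k} (hx : IsPoint x) :
    ∃ i, x = simplexVertex i := by
  obtain ⟨i, hi⟩ : ∃ i, x i = true := by
    by_contra! h
    refine hx.1 fun y i => ?_
    rw [Bool.eq_false_of_not_eq_true (h i)]
    exact Bool.false_le _
  refine ⟨i, ?_⟩
  rcases hx.2 _ (simplexVertex_le_iff.2 hi) with h | h
  · exact h.symm
  · exact ((isPoint_simplexVertex i).1 h).elim

theorem isApex_simplexVertex (i : Fin k) : IsApex (simplexVertex i) := by
  refine ⟨isPoint_simplexVertex i, fun b hb hne => ?_⟩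
  obtain ⟨j, rfl⟩ := exists_eq_simplexVertex hb
  have hij : j ≠ i := fun h => hne (h ▸ rfl)
  refine ⟨fun l => decide (l = i ∨ l = j), Pi.covBy_iff.2 ⟨j, ?_, fun l hl => ?_⟩,
    Pi.covBy_iff.2 ⟨i, ?_, fun l hl => ?_⟩⟩
  · simp [simplexVertex, hij]
  · simp [simplexVertex, hl]
  · simp [simplexVertex, hij.symm]
  · simp [simplexVertex, hl]

theorem determinedByPoints : Join.DeterminedByPoints (JoinPow Pt k) := by
  refine fun x y h => funext fun i => Bool.eq_iff_iff.2 ?_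
  rw [← simplexVertex_le_iff, ← simplexVertex_le_iff]
  exact h _ (isPoint_simplexVertex i)

/-- Permutations act on the simplex by automorphisms. -/
def act (k : ℕ) : Equiv.Perm (Fin k) →* Aut (JoinPow Pt k) where
  toFun σ := (Equiv.mk (fun x => x ∘ σ.symm) (fun x => x ∘ σ)
    (fun x => funext fun i => congrArg x (σ.symm_apply_apply i))
    (fun x => funext fun i => congrArg x (σ.apply_symm_apply i))).toOrderIso
      (fun _ _ h _ => h _) (fun _ _ h _ => h _)
  map_one' := rfl
  map_mul' _ _ := rfl

theorem act_simplexVertex (σ : Equiv.Perm (Fin k)) (i : Fin k) :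
    act k σ (simplexVertex i) = simplexVertex (σ i) :=
  funext fun j => by
    change decide (σ.symm j = i) = decide (j = σ i)
    simp only [Equiv.symm_apply_eq]

theorem act_injective : Function.Injective (act k) := by
  refine (injective_iff_map_eq_one _).2 fun σ hσ => Equiv.ext fun i => ?_
  have := act_simplexVertex σ i
  rw [hσ] at this
  exact (simplexVertex_injective this).symm

end JoinPow

section

variable {P : Type*} [PartialOrder P]

/-- An automorphism of `P * pt` that preserves the apex. -/
theorem Join.exists_eq_congr_pt {p : P} (hp : IsBot p) (f : Aut (Join P Pt))
    (hf : f (p, true) = (p, true)) : ∃ g : Aut P, f = congr g (OrderIso.refl Pt) :=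
  exists_eq_congr_of_points determinedByPoints_pt hp isBot_false f fun d hd => by
    rwa [isPoint_pt_iff.1 hd]

/-- Without apices in `P`, the apices of the join are exactly the vertices of the simplex, so `f`
permutes them. Undoing the permutation leaves these vertices fixed, and they determine the second
coordinate of every face. -/
theorem Join.exists_eq_congr_act {k : ℕ} {p : P} (hp : IsBot p) (hP : ∀ a : P, ¬ IsApex a)
    (f : Aut (Join P (JoinPow Pt k))) : ∃ g σ, f = congr g (JoinPow.act k σ) := by
  have h1 : ∀ i, ∃ j, f (p, simplexVertex i) = (p, simplexVertex j) := fun i => by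
    rcases isApex_cases hp JoinPow.isBot_bot
      ((isApex_snd hp JoinPow.isBot_bot (JoinPow.isApex_simplexVertex i)).map f) with
      ⟨a, ha, -⟩ | ⟨b, hb, h⟩
    · exact (hP a ha).elim
    · obtain ⟨j, rfl⟩ := JoinPow.exists_eq_simplexVertex hb
      exact ⟨j, h⟩
  choose σ hσ using h1
  have hinj : Function.Injective σ := fun i j hij => by
    have := f.injective ((hσ i).trans (hij ▸ (hσ j).symm))
    exact JoinPow.simplexVertex_injective (congrArg Prod.snd this)
  let e : Equiv.Perm (Fin k) := Equiv.ofBijective σ (Finite.injective_iff_bijective.1 hinj)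
  have he : ∀ i, congr (OrderIso.refl P) (JoinPow.act k e) (p, simplexVertex i) =
      (p, simplexVertex (σ i)) := fun i => Prod.ext rfl (JoinPow.act_simplexVertex e i)
  obtain ⟨g, hg⟩ := exists_eq_congr_of_points JoinPow.determinedByPoints hp JoinPow.isBot_bot
    ((congr (OrderIso.refl P) (JoinPow.act k e))⁻¹ * f) (fun d hd => by
      obtain ⟨i, rfl⟩ := JoinPow.exists_eq_simplexVertex hd
      rw [RelIso.mul_apply]
      exact (congrArg _ ((hσ i).trans (he i).symm)).trans (RelIso.inv_apply_self _ _))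
  refine ⟨g, e, ?_⟩
  rw [inv_mul_eq_iff_eq_mul] at hg
  exact hg

/-- The automorphism group of the join of `P` with a simplex. -/
theorem Join.nonempty_mulEquiv {k : ℕ} {p : P} (hp : IsBot p) (hP : ∀ a : P, ¬ IsApex a) :
    Nonempty (Aut (Join P (JoinPow Pt k)) ≃* Aut P × Equiv.Perm (Fin k)) := by
  let φ := (congrHom P (JoinPow Pt k)).comp ((MonoidHom.id (Aut P)).prodMap (JoinPow.act k))
  refine ⟨(MulEquiv.ofBijective φ ⟨?_, fun f => ?_⟩).symm⟩
  · exact (congrHom_injective p fun _ => false).comp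
      (Function.injective_id.prodMap JoinPow.act_injective)
  · obtain ⟨g, σ, rfl⟩ := exists_eq_congr_act hp hP f
    exact ⟨(g, σ), rfl⟩

end

/-- Join with a one-element poset, whose only element is least and hence no apex. -/
theorem JoinPow.act_surjective {k : ℕ} : Function.Surjective (act k) := fun f => by
  have hb : IsBot PUnit.unit.{1} := fun _ => le_rfl
  obtain ⟨g, σ, h⟩ := Join.exists_eq_congr_act hb (fun a h => h.1.1 fun _ => le_rfl)
    (Join.congr (OrderIso.refl PUnit.{1}) f)
  have := Join.congrHom_injective PUnit.unit.{1} (fun _ => false : JoinPow Pt k)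
    (a₁ := (1, f)) (a₂ := (g, act k σ)) h
  exact ⟨σ, (Prod.ext_iff.1 this).2.symm⟩

/-- A prism over a polytope of positive rank has no apex. -/
theorem not_isApex_cartProd_edge {n : ℕ} {R : Type*} [PartialOrder R] (hR : IsPolytope n R)
    (hn : 1 ≤ n) (x : CartProd R Edge) : ¬ IsApex x := by
  rintro ⟨hx, hx'⟩
  obtain ⟨b, hb⟩ := hR.exists_bot
  obtain ⟨r₁, r₂, hr, h₁, h₂⟩ := hR.exists_two_atoms hn hb
  obtain ⟨a, s, ha, hs, rfl⟩ := CartProd.exists_eq_pair hx.1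
  obtain ⟨r, har, hr⟩ : ∃ r, r ≠ a ∧ IsPoint r := by
    by_cases h : r₁ = a
    · exact ⟨r₂, fun h' => hr (h.trans h'.symm), isPoint_of_covBy hb h₂⟩
    · exact ⟨r₁, h, isPoint_of_covBy hb h₁⟩
  rcases edge_cases_of_not_isBot hs with ⟨z, rfl⟩ | rfl
  -- This vertex differs from `(a, {z})` in both coordinates. A common cover would contain the whole
  -- edge in its second coordinate; being a cover, it would then have first coordinate both `a` and
  -- `r`.
  · have hpt : IsPoint (CartProd.pair r {z + 1} hr.1 (not_isBot_singleton _)) := by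
      refine ⟨CartProd.not_isBot_pair, fun y hy => ?_⟩
      by_cases hyb : IsBot y
      · exact Or.inr hyb
      · obtain ⟨c, t, hc, ht, rfl⟩ := CartProd.exists_eq_pair hyb
        exact Or.inl (CartProd.pair_inj.2
          ⟨(hr.2 c hy.1).resolve_right hc, eq_singleton_of_le ht hy.2⟩)
    obtain ⟨c, h1, h2⟩ := hx' _ hpt fun h => har (CartProd.pair_inj.1 h).1
    obtain ⟨c, t, hc, ht, rfl⟩ := CartProd.exists_eq_pair (not_isBot_of_lt h1.1)
    have hle1 := CartProd.pair_le_pair.1 h1.le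
    have hle2 := CartProd.pair_le_pair.1 h2.le
    obtain rfl : t = Finset.univ := by
      have : ∀ (z : ZMod 2) (t : Edge), ({z} : Edge) ≤ t → ({z + 1} : Edge) ≤ t →
          t = Finset.univ := by decide
      exact this z t hle1.2 hle2.2
    have hca : a = c := by
      by_contra hne
      exact h1.2 (c := CartProd.pair a Finset.univ ha ht)
        (CartProd.pair_lt_pair.2 (Or.inr ⟨le_rfl, singleton_lt_univ z⟩))
        (CartProd.pair_lt_pair.2 (Or.inl ⟨hle1.1.lt_of_ne hne, le_rfl⟩))
    have hcr : r = c := by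
      by_contra hne
      exact h2.2 (c := CartProd.pair r Finset.univ hr.1 ht)
        (CartProd.pair_lt_pair.2 (Or.inr ⟨le_rfl, singleton_lt_univ _⟩))
        (CartProd.pair_lt_pair.2 (Or.inl ⟨hle2.1.lt_of_ne hne, le_rfl⟩))
    exact har (hcr.trans hca.symm)
  · rcases hx.2 (CartProd.pair a {0} ha (not_isBot_singleton 0))
      ⟨le_rfl, (singleton_lt_univ 0).le⟩ with h | h
    · exact (singleton_lt_univ 0).ne (CartProd.pair_inj.1 h).2
    · exact CartProd.not_isBot_pair h

/-- Rank at least 2 excludes `pt × I`, the edge, both of whose vertices are apices. -/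
theorem not_isApex_of_isPrism {n : ℕ} (hn : 2 ≤ n) {Q : Type u} [PartialOrder Q]
    (hQ : IsPolytope n Q) (hpr : IsPrism Q) (a : Q) : ¬ IsApex a := by
  obtain ⟨R, _, m, hR, ⟨e⟩⟩ := hpr
  exact fun h => not_isApex_cartProd_edge hR (hQ.one_le_of_cartProd_edge hn hR e) _ (h.map e)

theorem nonempty_aut_simplex {P : Type*} [PartialOrder P] {k : ℕ} (e : P ≃o JoinPow Pt k) :
    Nonempty (Aut P ≃* Equiv.Perm (Fin k)) := by
  obtain ⟨φ⟩ := nonempty_aut_mulEquiv e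
  exact ⟨φ.trans (MulEquiv.ofBijective (JoinPow.act k)
    ⟨JoinPow.act_injective, JoinPow.act_surjective⟩).symm⟩

theorem nonempty_aut_join_simplex {P : Type*} {Q : Type u} [PartialOrder P] [PartialOrder Q]
    {n k : ℕ} (hn : 2 ≤ n) (hQ : IsPolytope n Q) (hpr : IsPrism Q)
    (e : P ≃o Join Q (JoinPow Pt k)) : Nonempty (Aut P ≃* Aut Q × Equiv.Perm (Fin k)) := by
  obtain ⟨φ⟩ := nonempty_aut_mulEquiv e
  obtain ⟨b, hb⟩ := hQ.exists_bot
  obtain ⟨ψ⟩ := Join.nonempty_mulEquiv hb (not_isApex_of_isPrism hn hQ hpr)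
  exact ⟨φ.trans ψ⟩

/-! ## Associativity of the products -/

section Assoc

variable {P Q R : Type*} [PartialOrder P] [PartialOrder Q] [PartialOrder R]

namespace CartProd

/-- As an equivalence the condition on pairs is transitive, which gives associativity. -/
theorem mem_iff {p : P} {q : Q} :
    ((¬ IsBot p ∧ ¬ IsBot q) ∨ (IsBot p ∧ IsBot q)) ↔ (IsBot p ↔ IsBot q) := by
  tauto

theorem isBot_iff_isBot (x : CartProd P Q) : IsBot x.1.1 ↔ IsBot x.1.2 :=
  mem_iff.1 x.2

/-- Associativity of the Cartesian product. -/
def assoc : CartProd (CartProd P Q) R ≃o CartProd P (CartProd Q R) where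
  toFun x := ⟨(x.1.1.1.1, ⟨(x.1.1.1.2, x.1.2), mem_iff.2 ((isBot_iff_isBot x.1.1).symm.trans
      ((isBot_fst_iff x.1.1).trans (isBot_iff_isBot x)))⟩),
    mem_iff.2 ((isBot_iff_isBot x.1.1).trans (isBot_fst_iff
      (P := Q) (Q := R) ⟨(x.1.1.1.2, x.1.2), _⟩))⟩
  invFun x := ⟨(⟨(x.1.1, x.1.2.1.1), mem_iff.2 ((isBot_iff_isBot x).trans
      (isBot_fst_iff x.1.2).symm)⟩, x.1.2.1.2),
    mem_iff.2 ((isBot_snd_iff (P := P) (Q := Q) ⟨(x.1.1, x.1.2.1.1), _⟩).symm.trans (isBot_iff_isBot x.1.2))⟩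
  left_inv _ := rfl
  right_inv _ := rfl
  map_rel_iff' {_ _} := and_assoc.symm

/-- Commutativity of the Cartesian product. -/
def comm : CartProd P Q ≃o CartProd Q P where
  toFun x := ⟨(x.1.2, x.1.1), mem_iff.2 (isBot_iff_isBot x).symm⟩
  invFun x := ⟨(x.1.2, x.1.1), mem_iff.2 (isBot_iff_isBot x).symm⟩
  left_inv _ := rfl
  right_inv _ := rfl
  map_rel_iff' {_ _} := and_comm

end CartProd

/-- Associativity of the join. -/
def Join.assoc : Join (Join P Q) R ≃o Join P (Join Q R) := OrderIso.prodAssoc P Q R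

/-- `pt^{*(k+1)} = pt^{*k} * pt`. -/
def JoinPow.succ (P : Type*) [PartialOrder P] (k : ℕ) :
    Join (JoinPow P k) P ≃o JoinPow P (k + 1) :=
  OrderIso.prodComm.trans (Fin.snocOrderIso fun _ => P)

/-- `pt^{*1} = pt`. -/
def JoinPow.one (P : Type*) [PartialOrder P] : P ≃o JoinPow P 1 :=
  (OrderIso.funUnique (Fin 1) P).symm

end Assoc

/-! ## Decomposition of the constructed polytopes -/

/-- `w` is a cube, the product of the pyramid `v` and a cube, a simplex, or the join of the prism
`v` and a simplex. -/
inductive Decomposition (w : Construction) : Datum → Option Construction → Prop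
  | cube {k : ℕ} (hk : 1 ≤ k) (e : w.poly ≃o CartPow Edge k) :
      Decomposition w ⟨none, k, ProductKind.cartesian⟩ none
  | pyramid {v : Construction} {G : GroupExpr} {k : ℕ} (hk : 1 ≤ k) (hv : 2 ≤ v.dim)
      (hpyr : IsPyramid v.poly) (φ : Aut v.poly ≃* G.toGroup)
      (e : w.poly ≃o CartProd v.poly (CartPow Edge k)) :
      Decomposition w ⟨some G, k, ProductKind.cartesian⟩ (some v)
  | simplex {k : ℕ} (hk : 1 ≤ k) (e : w.poly ≃o JoinPow Pt k) :
      Decomposition w ⟨none, k, ProductKind.join⟩ none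
  | prism {v : Construction} {G : GroupExpr} {k : ℕ} (hk : 1 ≤ k) (hv : 2 ≤ v.dim)
      (hpr : IsPrism v.poly) (φ : Aut v.poly ≃* G.toGroup)
      (e : w.poly ≃o Join v.poly (JoinPow Pt k)) :
      Decomposition w ⟨some G, k, ProductKind.join⟩ (some v)

namespace Decomposition

variable {w : Construction} {d : Datum} {o : Option Construction}

theorem nonempty_aut (h : Decomposition w d o) : Nonempty (Aut w.poly ≃* d.result.toGroup) := by
  cases h with
  | cube hk e => exact nonempty_aut_cube hk e
  | @pyramid v G k hk hv hpyr φ e =>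
    obtain ⟨ψ⟩ := nonempty_aut_cartProd_cube hv hk v.isPolytope hpyr e
    exact ⟨ψ.trans (φ.prodCongr (MulEquiv.refl _))⟩
  | simplex hk e => exact nonempty_aut_simplex e
  | @prism v G k hk hv hpr φ e =>
    obtain ⟨ψ⟩ := nonempty_aut_join_simplex hv v.isPolytope hpr e
    exact ⟨ψ.trans (φ.prodCongr (MulEquiv.refl _))⟩

theorem rel (h : Decomposition w d o) :
    Option.Rel (fun (G : GroupExpr) (v : Construction) => Nonempty (Aut v.poly ≃* G.toGroup))
      d.A o := by
  cases h with
  | cube => exact Option.Rel.none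
  | pyramid _ _ _ φ _ => exact Option.Rel.some ⟨φ⟩
  | simplex => exact Option.Rel.none
  | prism _ _ _ φ _ => exact Option.Rel.some ⟨φ⟩

theorem timesEdge (h : Decomposition w d o) (hd : d.kind = ProductKind.cartesian) :
    Decomposition w.timesEdge d.timesEdge o := by
  cases h with
  | @cube k hk e =>
    obtain ⟨k, rfl⟩ := Nat.exists_eq_add_of_le' hk
    exact cube (by omega) ((CartProd.congr e (OrderIso.refl Edge)).trans (CartPow.succ k).symm)
  | @pyramid v G k hk hv hpyr φ e =>
    obtain ⟨k, rfl⟩ := Nat.exists_eq_add_of_le' hk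
    exact pyramid (by omega) hv hpyr φ (((CartProd.congr e (OrderIso.refl Edge)).trans
      CartProd.assoc).trans (CartProd.congr (OrderIso.refl _) (CartPow.succ k).symm))
  | simplex => cases hd
  | prism => cases hd

theorem joinPt (h : Decomposition w d o) (hd : d.kind = ProductKind.join) :
    Decomposition w.joinPt d.joinPt o := by
  cases h with
  | @simplex k hk e =>
    exact simplex (by omega) ((Join.congr e (OrderIso.refl Pt)).trans (JoinPow.succ Pt k))
  | @prism v G k hk hv hpr φ e =>
    exact prism (by omega) hv hpr φ (((Join.congr e (OrderIso.refl Pt)).trans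
      Join.assoc).trans (Join.congr (OrderIso.refl _) (JoinPow.succ Pt k)))
  | cube => cases hd
  | pyramid => cases hd

/-- When the product changes, `w` itself becomes the factor and the count restarts at 1. The group
to be stored is the one already computed for `w`. -/
theorem timesEdge_of_join (h : Decomposition w d o) (hd : d.kind = ProductKind.join)
    (hw : 2 ≤ w.dim) (hpyr : IsPyramid w.poly) :
    Decomposition w.timesEdge d.timesEdge (some w) := by
  obtain ⟨φ⟩ := h.nonempty_aut
  obtain ⟨A, k, kind⟩ := d
  subst hd
  exact pyramid le_rfl hw hpyr φ (CartProd.congr (OrderIso.refl _) CartPow.one.symm)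

theorem joinPt_of_cartesian (h : Decomposition w d o) (hd : d.kind = ProductKind.cartesian)
    (hw : 2 ≤ w.dim) (hpr : IsPrism w.poly) :
    Decomposition w.joinPt d.joinPt (some w) := by
  obtain ⟨φ⟩ := h.nonempty_aut
  obtain ⟨A, k, kind⟩ := d
  subst hd
  exact prism le_rfl hw hpr φ (Join.congr (OrderIso.refl _) (JoinPow.one Pt))

end Decomposition

namespace Construction

theorem data_timesEdge (w : Construction) : w.timesEdge.data = w.data.timesEdge := by
  cases w <;> rfl

theorem kind_timesEdge (w : Construction) : w.timesEdge.data.kind = ProductKind.cartesian := by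
  rw [data_timesEdge, Datum.timesEdge]
  split <;> rfl

theorem kind_joinPt (w : Construction) : w.joinPt.data.kind = ProductKind.join := by
  cases w with
  | edge => rfl
  | timesEdge w =>
    change (w.timesEdge.data.joinPt).kind = _
    rw [Datum.joinPt]
    split <;> rfl
  | joinPt w =>
    change (w.joinPt.data.joinPt).kind = _
    rw [Datum.joinPt]
    split <;> rfl

theorem isPyramid_joinPt (w : Construction) : IsPyramid w.joinPt.poly :=
  ⟨w.poly, inferInstance, w.dim, w.isPolytope, ⟨OrderIso.refl _⟩⟩

theorem isPrism_timesEdge (w : Construction) : IsPrism w.timesEdge.poly :=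
  ⟨w.poly, inferInstance, w.dim, w.isPolytope, ⟨OrderIso.refl _⟩⟩

theorem two_le_dim_joinPt (w : Construction) : 2 ≤ w.joinPt.dim :=
  Nat.succ_le_succ w.one_le_dim

theorem two_le_dim_timesEdge (w : Construction) : 2 ≤ w.timesEdge.dim :=
  Nat.succ_le_succ w.one_le_dim

/-- The edge is the simplex with two vertices. -/
def edgeSimplexIso : Edge ≃o JoinPow Pt 2 :=
  edgeIso.trans ((Join.congr (JoinPow.one Pt) (OrderIso.refl Pt)).trans (JoinPow.succ Pt 1))

/-- Indexing by the data and by the last polytope of the other kind lets one induction yield the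
shape, the computed group and the stored group. A repeated step lengthens the cube or simplex; a
change of step opens a new one. -/
theorem decomposition (w : Construction) : Decomposition w w.data w.lastOther := by
  induction w with
  | edge => exact .cube le_rfl CartPow.one.symm
  | timesEdge w ih =>
    rw [data_timesEdge]
    cases w with
    | edge => exact ih.timesEdge rfl
    | timesEdge w => exact ih.timesEdge w.kind_timesEdge
    | joinPt w => exact ih.timesEdge_of_join w.kind_joinPt w.two_le_dim_joinPt w.isPyramid_joinPt
  | joinPt w ih =>
    cases w with
    | edge =>
      -- The edge is also the simplex `pt^{*2}`, so `I * pt` is `pt^{*3}`; hence the initial value 3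
      -- of the algorithm.
      exact .simplex (by omega)
        ((Join.congr edgeSimplexIso (OrderIso.refl Pt)).trans (JoinPow.succ Pt 2))
    | timesEdge w =>
      exact ih.joinPt_of_cartesian w.kind_timesEdge w.two_le_dim_timesEdge w.isPrism_timesEdge
    | joinPt w => exact ih.joinPt w.kind_joinPt

theorem timesEdge_cases (w : Construction) :
    (∃ k : ℕ, 1 ≤ k ∧ Nonempty (w.timesEdge.poly ≃o CartPow Edge k)) ∨
    (∃ (v : Construction) (k : ℕ), 1 ≤ k ∧ 2 ≤ v.dim ∧ IsPyramid v.poly ∧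
      Nonempty (w.timesEdge.poly ≃o CartProd v.poly (CartPow Edge k))) := by
  have h := w.timesEdge.decomposition
  have hkind := w.kind_timesEdge
  generalize w.timesEdge.data = d at h hkind
  generalize w.timesEdge.lastOther = o at h
  cases h with
  | cube hk e => exact Or.inl ⟨_, hk, ⟨e⟩⟩
  | pyramid hk hv hpyr _ e => exact Or.inr ⟨_, _, hk, hv, hpyr, ⟨e⟩⟩
  | simplex => cases hkind
  | prism => cases hkind

theorem joinPt_cases (w : Construction) :
    (∃ k : ℕ, 1 ≤ k ∧ Nonempty (w.joinPt.poly ≃o JoinPow Pt k)) ∨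
    (∃ (v : Construction) (k : ℕ), 1 ≤ k ∧ 2 ≤ v.dim ∧ IsPrism v.poly ∧
      Nonempty (w.joinPt.poly ≃o Join v.poly (JoinPow Pt k))) := by
  have h := w.joinPt.decomposition
  have hkind := w.kind_joinPt
  generalize w.joinPt.data = d at h hkind
  generalize w.joinPt.lastOther = o at h
  cases h with
  | simplex hk e => exact Or.inl ⟨_, hk, ⟨e⟩⟩
  | prism hk hv hpr _ e => exact Or.inr ⟨_, _, hk, hv, hpr, ⟨e⟩⟩
  | cube => cases hkind
  | pyramid => cases hkind

end Construction

theorem closure_image_le {G H : Type*} [Group G] [Group H] (φ : G →* H) {S : Set G}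
    (hS : Subgroup.closure S = ⊤) {K : Subgroup H} (h : φ '' S ⊆ K) (g : G) : φ g ∈ K := by
  have : Subgroup.closure S ≤ K.comap φ :=
    (Subgroup.closure_le _).2 fun s hs => h (Set.mem_image_of_mem φ hs)
  exact this (hS ▸ Subgroup.mem_top g)

/-! ## Vertices -/

theorem isVertex_iff_isPoint {P : Type*} [PartialOrder P] (hP : ∃ b : P, IsBot b) (x : P) :
    IsVertex x ↔ IsPoint x := by
  obtain ⟨b, hb⟩ := hP
  have hbot : ∀ y : P, 1 ≤ Order.height y ↔ ¬ IsBot y := fun y => by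
    rw [Order.one_le_iff_ne_zero, Order.height_ne_zero, not_iff_not]
    exact ⟨fun h => (le_antisymm (hb y) (h (hb y))) ▸ hb, fun h => h.isMin⟩
  have h1 : IsVertex x ↔ Order.height x = (1 : ℕ) := by
    -- The default value 0 of `toNat` at infinity does no harm, because the value here is 1.
    rw [IsVertex, rank, sub_eq_zero, ← ENat.toNat_eq_iff one_ne_zero]
    norm_cast
  rw [h1, Order.height_eq_coe_iff_minimal_le_height]
  simp only [Nat.cast_one, hbot, Minimal, IsPoint]
  refine and_congr_right fun _ => ⟨fun h y hy => ?_, fun h y hy hyx => ?_⟩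
  · by_cases hyb : IsBot y
    · exact Or.inr hyb
    · exact Or.inl (le_antisymm hy (h hyb hy))
  · exact ((h y hyx).resolve_right hy).ge

theorem cubeVertex_injective {k : ℕ} : Function.Injective (cubeVertex (k := k)) :=
  fun _ _ h => funext fun i => Finset.singleton_injective (congrFun (congrArg Subtype.val h) i)

theorem range_cubeVertex (m : ℕ) :
    Set.range (cubeVertex (k := m + 1)) = {x | IsVertex x} := by
  ext x
  have hbot : IsBot (⟨fun _ => ∅, Or.inr fun _ => isBot_edge_iff.2 rfl⟩ : CartPow Edge (m + 1)) :=
    fun _ _ => Finset.empty_subset _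
  refine Iff.trans ?_ (isVertex_iff_isPoint ⟨_, hbot⟩ x).symm
  constructor
  · rintro ⟨z, rfl⟩
    refine ⟨fun h => not_isBot_singleton _ ((CartPow.isBot_iff_apply _ 0).1 h), fun y hy => ?_⟩
    by_cases hyb : IsBot y
    · exact Or.inr hyb
    · exact Or.inl (CartPow.ext fun i => eq_singleton_of_le
        (fun h => hyb ((CartPow.isBot_iff_apply y i).2 h)) (hy i))
  · intro hx
    have : ∀ i, ∃ z, ({z} : Edge) ≤ x.1 i := fun i => by
      have h := (not_congr (CartPow.isBot_iff_apply x i)).1 hx.1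
      rw [isBot_edge_iff, ← Ne, ← Finset.nonempty_iff_ne_empty] at h
      obtain ⟨z, hz⟩ := h
      exact ⟨z, Finset.singleton_subset_iff.2 hz⟩
    choose z hz using this
    refine ⟨z, (hx.2 (cubeVertex z) hz).resolve_right fun h => ?_⟩
    exact not_isBot_singleton _ ((CartPow.isBot_iff_apply _ 0).1 h)

theorem range_simplexVertex (k : ℕ) :
    Set.range (simplexVertex (k := k)) = {x | IsVertex x} := by
  ext x
  refine Iff.trans ?_ (isVertex_iff_isPoint ⟨_, JoinPow.isBot_bot⟩ x).symm
  constructor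
  · rintro ⟨i, rfl⟩
    exact JoinPow.isPoint_simplexVertex i
  · intro hx
    obtain ⟨i, rfl⟩ := JoinPow.exists_eq_simplexVertex hx
    exact ⟨i, rfl⟩

/-! ## Generators for cubes and simplices -/

theorem closure_swap (m : ℕ) :
    Subgroup.closure (Set.range fun i : Fin m => Equiv.swap i.castSucc i.succ) = ⊤ :=
  Subgroup.closure_eq_top_of_mclosure_eq_top (Equiv.Perm.mclosure_swap_castSucc_succ m)

/-- The sign change of the `i`-th coordinate. -/
def SignedPerm.flip {k : ℕ} (i : Fin k) : SignedPerm k :=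
  SemidirectProduct.inl (Pi.mulSingle i (Multiplicative.ofAdd (1 : ZMod 2)))

/-- The permutations of the coordinates. -/
def SignedPerm.perm (k : ℕ) : Equiv.Perm (Fin k) →* SignedPerm k := SemidirectProduct.inr

/-- Adjacent transpositions give all permutations, conjugation by these turns the first sign change
into any other, and the sign changes generate `(ℤ/2)^{m+1}`. -/
theorem closure_signedPerm (m : ℕ) :
    Subgroup.closure (insert (SignedPerm.flip 0)
      (Set.range fun i : Fin m => SignedPerm.perm (m + 1) (Equiv.swap i.castSucc i.succ))) = ⊤ := by
  set K := Subgroup.closure (insert (SignedPerm.flip 0)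
    (Set.range fun i : Fin m => SignedPerm.perm (m + 1) (Equiv.swap i.castSucc i.succ))) with hK
  have hr : ∀ σ, SignedPerm.perm (m + 1) σ ∈ K := by
    refine closure_image_le (SignedPerm.perm (m + 1)) (closure_swap m) ?_
    rintro _ ⟨_, ⟨i, rfl⟩, rfl⟩
    exact Subgroup.subset_closure (Set.mem_insert_of_mem _ ⟨i, rfl⟩)
  have h0 : SignedPerm.flip 0 ∈ K := Subgroup.subset_closure (Set.mem_insert _ _)
  have hi : ∀ i, SignedPerm.flip i ∈ K := by
    intro i
    have := K.mul_mem (K.mul_mem (hr (Equiv.swap 0 i)) h0) (hr (Equiv.swap 0 i)⁻¹)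
    rw [SignedPerm.perm, SignedPerm.flip, ← SemidirectProduct.inl_aut] at this
    refine (congrArg (· ∈ K) (congrArg SemidirectProduct.inl (funext fun j => ?_))).mpr this
    change _ = (Pi.mulSingle 0 (Multiplicative.ofAdd 1) : Fin (m + 1) → Multiplicative (ZMod 2))
      (Equiv.swap 0 i j)
    rw [Pi.mulSingle_apply, Pi.mulSingle_apply]
    refine if_congr ?_ rfl rfl
    rw [Equiv.swap_apply_eq_iff, Equiv.swap_apply_left]
  have hl : ∀ n : Fin (m + 1) → Multiplicative (ZMod 2),
      (SemidirectProduct.inl n : SignedPerm (m + 1)) ∈ K := by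
    intro n
    change n ∈ K.comap SemidirectProduct.inl
    rw [← Finset.univ_prod_mulSingle n]
    refine Subgroup.prod_mem _ fun i _ => ?_
    rcases (show ∀ z : Multiplicative (ZMod 2), z = 1 ∨ z = Multiplicative.ofAdd 1 by decide)
      (n i) with h | h
    · rw [h, Pi.mulSingle_one]
      exact Subgroup.one_mem _
    · rw [h]
      exact hi i
  refine (Subgroup.eq_top_iff' K).2 fun w => ?_
  rw [← SemidirectProduct.inl_left_mul_inr_right w]
  exact K.mul_mem (hl _) (hr _)

theorem act_cubeVertex {k : ℕ} (w : SignedPerm k) (z : Fin k → ZMod 2) :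
    CartPow.act k w (cubeVertex z) =
      cubeVertex fun i => z (w.right⁻¹ i) + (w.left i).toAdd :=
  CartPow.ext fun _ => edgeAdd_singleton _ _

theorem exists_generators_cube (m : ℕ) :
    ∃ (σ : Aut (CartPow Edge (m + 1))) (s : Fin m → Aut (CartPow Edge (m + 1))),
      (∀ z, σ (cubeVertex z) = cubeVertex (Function.update z 0 (z 0 + 1))) ∧
      (∀ i z, s i (cubeVertex z) = cubeVertex (z ∘ Equiv.swap i.castSucc i.succ)) ∧
      Subgroup.closure (insert σ (Set.range s)) = ⊤ := by
  refine ⟨CartPow.act _ (SignedPerm.flip 0),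
    fun i => CartPow.act _ (SignedPerm.perm _ (Equiv.swap i.castSucc i.succ)),
    fun z => ?_, fun i z => ?_, ?_⟩
  · rw [act_cubeVertex]
    refine congrArg _ (funext fun i => ?_)
    change z i + ((Pi.mulSingle 0 (Multiplicative.ofAdd 1) :
      Fin (m + 1) → Multiplicative (ZMod 2)) i).toAdd = _
    by_cases hi : i = 0
    · subst hi
      rw [Pi.mulSingle_eq_same, Function.update_self, toAdd_ofAdd]
    · rw [Pi.mulSingle_eq_of_ne hi, Function.update_of_ne hi, toAdd_one, add_zero]
  · rw [act_cubeVertex]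
    refine congrArg _ (funext fun j => ?_)
    -- The action involves the inverse permutation, but a transposition is its own inverse.
    exact add_zero _
  · refine (Subgroup.eq_top_iff' _).2 fun f => ?_
    obtain ⟨w, rfl⟩ := CartPow.act_surjective (Nat.le_add_left 1 m) f
    refine closure_image_le (CartPow.act (m + 1)) (closure_signedPerm m) ?_ w
    rintro _ ⟨_, rfl | ⟨i, rfl⟩, rfl⟩
    · exact Subgroup.subset_closure (Set.mem_insert _ _)
    · exact Subgroup.subset_closure (Set.mem_insert_of_mem _ ⟨i, rfl⟩)

theorem exists_generators_simplex (m : ℕ) :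
    ∃ s : Fin m → Aut (JoinPow Pt (m + 1)),
      (∀ i j, s i (simplexVertex j) = simplexVertex (Equiv.swap i.castSucc i.succ j)) ∧
      Subgroup.closure (Set.range s) = ⊤ := by
  refine ⟨fun i => JoinPow.act _ (Equiv.swap i.castSucc i.succ),
    fun i j => JoinPow.act_simplexVertex _ _, (Subgroup.eq_top_iff' _).2 fun f => ?_⟩
  obtain ⟨σ, rfl⟩ := JoinPow.act_surjective f
  refine closure_image_le (JoinPow.act (m + 1)) (closure_swap m) ?_ σ
  rintro _ ⟨_, ⟨i, rfl⟩, rfl⟩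
  exact Subgroup.subset_closure ⟨i, rfl⟩

/-! ## Generators for the constructed polytopes -/

namespace CartProd

variable {P Q : Type*} [PartialOrder P] [PartialOrder Q]

theorem swapLast_pair {p : P} {q q' : Q} (hp : ¬ IsBot p) (hq : ¬ IsBot q) (hq' : ¬ IsBot q') :
    swapLast (pair (pair p q hp hq) q' not_isBot_pair hq') =
      pair (pair p q' hp hq') q not_isBot_pair hq :=
  rfl

/-- The automorphisms of `P × Q` that come from automorphisms of `P`. -/
def congrLeft (P Q : Type*) [PartialOrder P] [PartialOrder Q] : Aut P →* Aut (CartProd P Q) :=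
  (congrHom P Q).comp (MonoidHom.inl (Aut P) (Aut Q))

theorem pair_congr {p p' : P} {q q' : Q} {hp : ¬ IsBot p} {hq : ¬ IsBot q} (h : p = p')
    (h' : q = q') : pair p q hp hq = pair p' q' (h ▸ hp) (h' ▸ hq) := by
  subst h h'
  rfl

/-- Every automorphism of `P × I` preserves the two copies of `P` or takes them to a pair
of opposite facets that comes from `P`. -/
theorem aut_cases {p : P} (hp : ¬ IsBot p) (hpt : IsTop p) (f : Aut (CartProd P Edge)) :
    (∃ g a, f = congr g (edgeAdd a)) ∨
      ∃ c d, ∃ h : Opposite c d,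
        f (pair p {0} hp (not_isBot_singleton 0)) = pair c Finset.univ h.1.1 not_isBot_univ ∧
        f (pair p {1} hp (not_isBot_singleton 1)) = pair d Finset.univ h.2.1.1 not_isBot_univ := by
  have h01 : Opposite ({0} : Edge) {1} := opposite_edge_iff.2 ⟨0, rfl, rfl⟩
  rcases opposite_cases hp not_isBot_univ hpt isTop_univ_edge
    ((opposite_pair_top hp hpt h01).map f) with h | ⟨c, d, h, hc, hd⟩
  · exact Or.inr h
  · obtain ⟨a, rfl, rfl⟩ := opposite_edge_iff.1 h
    obtain ⟨g, hg⟩ := exists_eq_congr_edgeAdd hp hpt f a fun z => by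
      rcases (show ∀ z : ZMod 2, z = 0 ∨ z = 1 by decide) z with rfl | rfl
      · exact hc.trans (pair_congr rfl (by rw [zero_add]))
      · exact hd.trans (pair_congr rfl (by rw [add_comm]))
    exact Or.inl ⟨g, a, hg⟩

end CartProd

theorem CartProd.exists_aut_of_opposite_last {P : Type*} [PartialOrder P] {t : P}
    (ht : ¬ IsBot t) {c d : Edge} (h : Opposite c d) : ∃ g : Aut (CartProd P Edge),
      g (pair t {0} ht (not_isBot_singleton 0)) = pair t c ht h.1.1 ∧
      g (pair t {1} ht (not_isBot_singleton 1)) = pair t d ht h.2.1.1 := by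
  obtain ⟨z, rfl, rfl⟩ := opposite_edge_iff.1 h
  refine ⟨congr (OrderIso.refl P) (edgeAdd z),
    Subtype.ext (Prod.ext rfl ?_), Subtype.ext (Prod.ext rfl ?_)⟩
  · exact (edgeAdd_singleton z 0).trans (congrArg singleton (zero_add z))
  · exact (edgeAdd_singleton z 1).trans (congrArg singleton (add_comm 1 z))

open CartProd in
/-- Any two pairs of opposite facets of `R × I` are equivalent under automorphisms. -/
theorem Construction.exists_aut_of_opposite (R : Construction) {t : R.poly} (ht : ¬ IsBot t)
    (htt : IsTop t) {c d : CartProd R.poly Edge} (h : Opposite c d) :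
    ∃ g : Aut (CartProd R.poly Edge),
      g (pair t {0} ht (not_isBot_singleton 0)) = c ∧
      g (pair t {1} ht (not_isBot_singleton 1)) = d := by
  induction R with
  | edge =>
    rcases opposite_cases ht not_isBot_univ htt isTop_univ_edge h with
      ⟨c, d, h', rfl, rfl⟩ | ⟨c, d, h', rfl, rfl⟩
    · obtain rfl : t = Finset.univ := isTop_edge_iff.1 htt
      obtain ⟨z, rfl, rfl⟩ := opposite_edge_iff.1 h'
      -- In the square, exchanging the two factors carries the pair of the last factor to that of
      -- the first.
      refine ⟨(congr (OrderIso.refl Edge) (edgeAdd z)).trans comm,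
        Subtype.ext (Prod.ext ?_ rfl), Subtype.ext (Prod.ext ?_ rfl)⟩
      · exact (edgeAdd_singleton z 0).trans (congrArg singleton (zero_add z))
      · exact (edgeAdd_singleton z 1).trans (congrArg singleton (add_comm 1 z))
    · exact exists_aut_of_opposite_last ht h'
  | timesEdge R ih =>
    rcases opposite_cases ht not_isBot_univ htt isTop_univ_edge h with
      ⟨c, d, h', rfl, rfl⟩ | ⟨c, d, h', rfl, rfl⟩
    · obtain ⟨t', ht'⟩ := R.isPolytope.exists_top
      have hb' := R.isPolytope.not_isBot_of_isTop R.one_le_dim ht'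
      obtain ⟨g, rfl, rfl⟩ := ih hb' ht' h'
      obtain rfl : t = pair t' Finset.univ hb' not_isBot_univ :=
        le_antisymm (isTop_pair ht' isTop_univ_edge t) (htt _)
      -- The swap moves the last pair into the factor `R × I`, where `g` takes it to the required
      -- one.
      exact ⟨congrLeft _ _ g * swapLast, rfl, rfl⟩
    · exact exists_aut_of_opposite_last ht h'
  | joinPt R =>
    rcases opposite_cases ht not_isBot_univ htt isTop_univ_edge h with
      ⟨c, d, h', rfl, rfl⟩ | ⟨c, d, h', rfl, rfl⟩
    · exact (not_opposite_join_pt R.isPolytope R.one_le_dim c d h').elim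
    · exact exists_aut_of_opposite_last ht h'

open CartProd in
/-- The prism `R × I`: generators for `(R × I) × I`. -/
theorem Construction.closure_prism_timesEdge (R : Construction)
    (S : Set (Aut (CartProd R.poly Edge))) (hS : Subgroup.closure S = ⊤) :
    Subgroup.closure (insert swapLast ((fun f => congr f (OrderIso.refl Edge)) '' S) :
      Set (Aut (CartProd (CartProd R.poly Edge) Edge))) = ⊤ := by
  set K := Subgroup.closure (insert swapLast ((fun f => congr f (OrderIso.refl Edge)) '' S) :
    Set (Aut (CartProd (CartProd R.poly Edge) Edge))) with hK
  have hswap : swapLast ∈ K := Subgroup.subset_closure (Set.mem_insert _ _)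
  have hleft : ∀ g, congrLeft _ Edge g ∈ K := closure_image_le (congrLeft _ Edge) hS
    ((Set.subset_insert _ _).trans Subgroup.subset_closure)
  obtain ⟨t, ht⟩ := R.isPolytope.exists_top
  have hb := R.isPolytope.not_isBot_of_isTop R.one_le_dim ht
  have hb' : ¬ IsBot (pair t (Finset.univ : Edge) hb not_isBot_univ) := not_isBot_pair
  have ht' := isTop_pair (hp := hb) (hq := not_isBot_univ) ht isTop_univ_edge
  have hlast : ∀ g a, congr g (edgeAdd a) ∈ K := fun g a => by
    -- A translation of the last edge is the conjugate, under the swap, of the same translation of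
    -- the preceding edge, which already lies in `Aut (R × I)`.
    have : congr g (edgeAdd a) = congrLeft _ Edge g *
      (swapLast * congrLeft _ Edge (congr (OrderIso.refl R.poly) (edgeAdd a)) * swapLast) := rfl
    rw [this]
    exact K.mul_mem (hleft g) (K.mul_mem (K.mul_mem hswap (hleft _)) hswap)
  refine (Subgroup.eq_top_iff' K).2 fun f => ?_
  rcases aut_cases hb' ht' f with ⟨g, a, rfl⟩ | ⟨c, d, h, h0, h1⟩
  · exact hlast g a
  · obtain ⟨g, rfl, rfl⟩ := R.exists_aut_of_opposite hb ht h
    -- Undoing `g` moves the images of the two copies to the standard pair of `R × I`, and the swap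
    -- then returns them to their places. The shift 0 records that the copies are not exchanged.
    have key : ∀ z, (swapLast * ((congrLeft _ Edge g)⁻¹ * f) :
        Aut (CartProd (CartProd R.poly Edge) Edge))
        (pair (pair t Finset.univ hb not_isBot_univ) {z} hb' (not_isBot_singleton z)) =
        pair (pair t Finset.univ hb not_isBot_univ) {z + 0} hb' (not_isBot_singleton _) := by
      have hz : ∀ z, f (pair (pair t Finset.univ hb not_isBot_univ) {z} hb'
          (not_isBot_singleton z)) = congrLeft _ Edge g
          (pair (pair t {z} hb (not_isBot_singleton z)) Finset.univ not_isBot_pair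
            not_isBot_univ) := fun z => by
        rcases (show ∀ z : ZMod 2, z = 0 ∨ z = 1 by decide) z with rfl | rfl
        · exact h0
        · exact h1
      intro z
      rw [RelIso.mul_apply, RelIso.mul_apply, hz, RelIso.inv_apply_self, swapLast_pair]
      exact pair_congr rfl (by rw [add_zero])
    obtain ⟨g', hg'⟩ := exists_eq_congr_edgeAdd hb' ht' _ 0 key
    have : f = congrLeft _ Edge g * (swapLast⁻¹ * congr g' (edgeAdd 0)) := by
      rw [← hg']
      group
    rw [this]
    exact K.mul_mem (hleft g) (K.mul_mem (K.inv_mem hswap) (hlast g' 0))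

open CartProd in
/-- The pyramid `R * pt`: generators for `(R * pt) × I`. -/
theorem Construction.closure_pyramid_timesEdge (R : Construction)
    (τ : Aut (CartProd (Join R.poly Pt) Edge)) (hτ : SwapsCopies τ)
    (S : Set (Aut (Join R.poly Pt))) (hS : Subgroup.closure S = ⊤) :
    Subgroup.closure (insert τ ((fun f => congr f (OrderIso.refl Edge)) '' S) :
      Set (Aut (CartProd (Join R.poly Pt) Edge))) = ⊤ := by
  set K := Subgroup.closure (insert τ ((fun f => congr f (OrderIso.refl Edge)) '' S) :
    Set (Aut (CartProd (Join R.poly Pt) Edge))) with hK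
  have hτK : τ ∈ K := Subgroup.subset_closure (Set.mem_insert _ _)
  have hleft : ∀ g, congrLeft _ Edge g ∈ K := closure_image_le (congrLeft _ Edge) hS
    ((Set.subset_insert _ _).trans Subgroup.subset_closure)
  obtain ⟨t, ht⟩ := R.joinPt.isPolytope.exists_top
  have hb : ¬ IsBot t := R.joinPt.isPolytope.not_isBot_of_isTop R.joinPt.one_le_dim ht
  -- A pyramid has no opposite facets to which the two copies could be moved.
  have hcases : ∀ f : Aut (CartProd (Join R.poly Pt) Edge),
      ∃ g a, f = congr g (edgeAdd a) := fun f => by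
    rcases aut_cases hb ht f with h | ⟨c, d, h, -⟩
    · exact h
    · exact (not_opposite_join_pt R.isPolytope R.one_le_dim c d h).elim
  obtain ⟨g₀, a₀, h₀⟩ := hcases τ
  have ha₀ : a₀ = 1 := by
    have h1 := hτ (pair t {0} hb (not_isBot_singleton 0)) 0 rfl
    rw [h₀] at h1
    have h2 : edgeAdd a₀ {0} = {0 + 1} := h1
    rw [edgeAdd_singleton] at h2
    simpa using Finset.singleton_injective h2
  subst ha₀
  refine (Subgroup.eq_top_iff' K).2 fun f => ?_
  obtain ⟨g, a, rfl⟩ := hcases f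
  rcases (show ∀ z : ZMod 2, z = 0 ∨ z = 1 by decide) a with rfl | rfl
  · have : congr g (edgeAdd 0) = congrLeft _ Edge g :=
      RelIso.ext fun x => Subtype.ext (Prod.ext rfl (edgeAdd_zero _))
    rw [this]
    exact hleft g
  -- An arbitrary swap `τ` may also act on the first factor by some `g₀`, which is corrected by an
  -- element generated by `S`.
  · have : congr g (edgeAdd 1) = congrLeft _ Edge (g * g₀⁻¹) * τ := by
      rw [h₀]
      refine RelIso.ext fun x => Subtype.ext (Prod.ext ?_ rfl)
      exact congrArg g (RelIso.inv_apply_self g₀ _).symm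
    rw [this]
    exact K.mul_mem (hleft _) hτK

theorem swapsCopies_congr_edgeFlip {P : Type*} [PartialOrder P] :
    SwapsCopies (CartProd.congr (OrderIso.refl P) edgeFlip) := fun x z hx => by
  change edgeFlip x.1.2 = _
  rw [hx, ← edgeAdd_one, edgeAdd_singleton]

namespace Join

variable {P Q : Type*} [PartialOrder P] [PartialOrder Q]

/-- The automorphisms of `P * Q` that come from automorphisms of `P`. -/
def congrLeft (P Q : Type*) [PartialOrder P] [PartialOrder Q] : Aut P →* Aut (Join P Q) :=
  (congrHom P Q).comp (MonoidHom.inl (Aut P) (Aut Q))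

/-- Every automorphism of `P * pt` preserves the apex or takes it to an apex of `P`. -/
theorem aut_cases {p : P} (hp : IsBot p) (f : Aut (Join P Pt)) :
    (∃ g, f = congr g (OrderIso.refl Pt)) ∨ ∃ a, IsApex a ∧ f (p, true) = (a, false) := by
  rcases isApex_cases hp isBot_false ((isApex_snd hp isBot_false isApex_true).map f) with
    h | ⟨b, hb, h⟩
  · exact Or.inr h
  · rw [isPoint_pt_iff.1 hb] at h
    exact Or.inl (exists_eq_congr_pt hp f h)

end Join

open Join in
/-- Any two apices of `R * pt` are equivalent under automorphisms. -/
theorem Construction.exists_aut_of_isApex (R : Construction) {b : R.poly} (hb : IsBot b)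
    {a : Join R.poly Pt} (ha : IsApex a) : ∃ g : Aut (Join R.poly Pt), g (b, true) = a := by
  induction R with
  | edge =>
    rcases isApex_cases hb isBot_false ha with ⟨a, ha', rfl⟩ | ⟨d, hd, rfl⟩
    · obtain ⟨z, rfl⟩ : ∃ z, a = ({z} : Edge) := by
        rcases edge_cases_of_not_isBot ha'.1.1 with h | rfl
        · exact h
        · rcases ha'.1.2 ({0} : Edge) (singleton_lt_univ 0).le with h | h
          · exact ((singleton_lt_univ 0).ne h).elim
          · exact (not_isBot_singleton 0 h).elim
      obtain rfl : b = (∅ : Edge) := isBot_edge_iff.1 hb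
      -- With the edge written as `pt * pt`, the swap takes the apex to the vertex `{1}` of the
      -- edge; translation by `z + 1` takes `{1}` to `{z}`.
      refine ⟨(((congr edgeIso (OrderIso.refl Pt)).trans swapLast).trans
        (congr edgeIso.symm (OrderIso.refl Pt))).trans (congr (edgeAdd (z + 1)) (OrderIso.refl Pt)),
        Prod.ext ?_ rfl⟩
      change edgeAdd (z + 1) (edgeIso.symm (false, true)) = {z}
      clear ha ha'
      revert z
      decide
    · exact ⟨1, by rw [isPoint_pt_iff.1 hd]; rfl⟩
  | timesEdge R =>
    rcases isApex_cases hb isBot_false ha with ⟨a, ha', rfl⟩ | ⟨d, hd, rfl⟩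
    · exact (not_isApex_cartProd_edge R.isPolytope R.one_le_dim a ha').elim
    · exact ⟨1, by rw [isPoint_pt_iff.1 hd]; rfl⟩
  | joinPt R ih =>
    rcases isApex_cases hb isBot_false ha with ⟨a, ha', rfl⟩ | ⟨d, hd, rfl⟩
    · obtain ⟨b', hb'⟩ := R.isPolytope.exists_bot
      obtain ⟨g, rfl⟩ := ih hb' ha'
      obtain rfl : b = (b', false) := hb.eq (isBot_mk hb' isBot_false)
      exact ⟨congrLeft _ Pt g * swapLast, rfl⟩
    · exact ⟨1, by rw [isPoint_pt_iff.1 hd]; rfl⟩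

open Join CartProd in
/-- The prism `R × I`: generators for `(R × I) * pt`. -/
theorem Construction.closure_prism_joinPt (R : Construction)
    (S : Set (Aut (CartProd R.poly Edge))) (hS : Subgroup.closure S = ⊤) :
    Subgroup.closure ((fun f => Join.congr f (OrderIso.refl Pt)) '' S :
      Set (Aut (Join (CartProd R.poly Edge) Pt))) = ⊤ := by
  refine (Subgroup.eq_top_iff' _).2 fun f => ?_
  obtain ⟨b, hb⟩ := R.timesEdge.isPolytope.exists_bot
  rcases Join.aut_cases (P := CartProd R.poly Edge) hb f with ⟨g, rfl⟩ | ⟨a, ha, -⟩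
  · exact closure_image_le (Join.congrLeft _ Pt) hS Subgroup.subset_closure g
  -- A prism offers no apex as image, so the apex of the join is always fixed.
  · exact (not_isApex_cartProd_edge R.isPolytope R.one_le_dim a ha).elim

open Join in
/-- The pyramid `R * pt`: generators for `(R * pt) * pt`. -/
theorem Construction.closure_pyramid_joinPt (R : Construction)
    (S : Set (Aut (Join R.poly Pt))) (hS : Subgroup.closure S = ⊤) :
    Subgroup.closure (insert swapLast ((fun f => congr f (OrderIso.refl Pt)) '' S) :
      Set (Aut (Join (Join R.poly Pt) Pt))) = ⊤ := by
  set K := Subgroup.closure (insert swapLast ((fun f => congr f (OrderIso.refl Pt)) '' S) :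
    Set (Aut (Join (Join R.poly Pt) Pt))) with hK
  have hswap : swapLast ∈ K := Subgroup.subset_closure (Set.mem_insert _ _)
  have hleft : ∀ g, congrLeft _ Pt g ∈ K := closure_image_le (congrLeft _ Pt) hS
    ((Set.subset_insert _ _).trans Subgroup.subset_closure)
  obtain ⟨b, hb⟩ := R.isPolytope.exists_bot
  have hb' : IsBot ((b, false) : Join R.poly Pt) := isBot_mk hb isBot_false
  refine (Subgroup.eq_top_iff' K).2 fun f => ?_
  rcases aut_cases hb' f with ⟨g, rfl⟩ | ⟨a, ha, h⟩
  · exact hleft g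
  · obtain ⟨g, rfl⟩ := R.exists_aut_of_isApex hb ha
    -- Undoing `g` takes the image of the last apex to the apex of `R * pt`, and the swap takes it
    -- back to the last one.
    have key : (swapLast * ((congrLeft _ Pt g)⁻¹ * f) : Aut (Join (Join R.poly Pt) Pt))
        ((b, false), true) =
        ((b, false), true) := by
      have : f ((b, false), true) = congrLeft _ Pt g ((b, true), false) := h
      rw [RelIso.mul_apply, RelIso.mul_apply, this, RelIso.inv_apply_self]
      rfl
    obtain ⟨g', hg'⟩ := exists_eq_congr_pt hb' _ key
    have : f = congrLeft _ Pt g * (swapLast⁻¹ * congr g' (OrderIso.refl Pt)) := by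
      rw [← hg']
      group
    rw [this]
    exact K.mul_mem (hleft g) (K.mul_mem (K.inv_mem hswap) (hleft g'))

end InductivePolytopes

theorem mainTheorem3 :
    -- every constructed object is an abstract polytope of the expected rank
    (∀ w : Construction, IsPolytope w.dim w.poly) ∧
    -- a polytope whose last step is a Cartesian product is a cube or comes from a pyramid `Q`
    (∀ w : Construction,
      (∃ k : ℕ, 1 ≤ k ∧ Nonempty (w.timesEdge.poly ≃o CartPow Edge k)) ∨
      (∃ (v : Construction) (k : ℕ), 1 ≤ k ∧ 2 ≤ v.dim ∧ IsPyramid v.poly ∧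
        Nonempty (w.timesEdge.poly ≃o CartProd v.poly (CartPow Edge k)))) ∧
    -- a polytope whose last step is a join is a simplex or comes from a prism `Q`
    (∀ w : Construction,
      (∃ k : ℕ, 1 ≤ k ∧ Nonempty (w.joinPt.poly ≃o JoinPow Pt k)) ∨
      (∃ (v : Construction) (k : ℕ), 1 ≤ k ∧ 2 ≤ v.dim ∧ IsPrism v.poly ∧
        Nonempty (w.joinPt.poly ≃o Join v.poly (JoinPow Pt k)))) ∧
    -- `P = I^{×k}`
    (∀ (P : Type u) [PartialOrder P] (k : ℕ), 1 ≤ k →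
      Nonempty (P ≃o CartPow Edge k) → Nonempty (Aut P ≃* SignedPerm k)) ∧
    -- `P = Q × I^{×k}` with `Q` a pyramid of rank at least `2`
    (∀ (P Q : Type u) [PartialOrder P] [PartialOrder Q] (n k : ℕ), 2 ≤ n → 1 ≤ k →
      IsPolytope n Q → IsPyramid Q → Nonempty (P ≃o CartProd Q (CartPow Edge k)) →
      Nonempty (Aut P ≃* Aut Q × SignedPerm k)) ∧
    -- `P = pt^{*k}`
    (∀ (P : Type u) [PartialOrder P] (k : ℕ), 1 ≤ k →
      Nonempty (P ≃o JoinPow Pt k) → Nonempty (Aut P ≃* Equiv.Perm (Fin k))) ∧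
    -- `P = Q * pt^{*k}` with `Q` a prism of rank at least `2`
    (∀ (P Q : Type u) [PartialOrder P] [PartialOrder Q] (n k : ℕ), 2 ≤ n → 1 ≤ k →
      IsPolytope n Q → IsPrism Q → Nonempty (P ≃o Join Q (JoinPow Pt k)) →
      Nonempty (Aut P ≃* Aut Q × Equiv.Perm (Fin k))) ∧
    -- the algorithm computes the automorphism group
    (∀ w : Construction, Nonempty (Aut w.poly ≃* w.data.result.toGroup)) ∧
    -- the stored group is the automorphism group of the last polytope of the other kind
    (∀ w : Construction,
      Option.Rel (fun (G : GroupExpr) (v : Construction) => Nonempty (Aut v.poly ≃* G.toGroup))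
        w.data.A w.lastOther) ∧
    -- generators of the automorphism group of the cube `I^{×(m+1)}`
    (∀ m : ℕ,
      Function.Injective (cubeVertex (k := m + 1)) ∧
      Set.range (cubeVertex (k := m + 1)) = {x | IsVertex x} ∧
      ∃ (σ : Aut (CartPow Edge (m + 1))) (s : Fin m → Aut (CartPow Edge (m + 1))),
        (∀ z, σ (cubeVertex z) = cubeVertex (Function.update z 0 (z 0 + 1))) ∧
        (∀ i z, s i (cubeVertex z) = cubeVertex (z ∘ Equiv.swap i.castSucc i.succ)) ∧
        Subgroup.closure (insert σ (Set.range s)) = ⊤) ∧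
    -- generators of the automorphism group of the simplex `pt^{*(m+1)}`
    (∀ m : ℕ,
      Function.Injective (simplexVertex (k := m + 1)) ∧
      Set.range (simplexVertex (k := m + 1)) = {x | IsVertex x} ∧
      ∃ s : Fin m → Aut (JoinPow Pt (m + 1)),
        (∀ i j, s i (simplexVertex j) = simplexVertex (Equiv.swap i.castSucc i.succ j)) ∧
        Subgroup.closure (Set.range s) = ⊤) ∧
    -- the prism `P = R × I`, generators for `P × I`
    (∀ (R : Construction) (S : Set (Aut (CartProd R.poly Edge))), Subgroup.closure S = ⊤ →
      Subgroup.closure (insert CartProd.swapLast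
        ((fun f => CartProd.congr f (OrderIso.refl Edge)) '' S) :
          Set (Aut (CartProd (CartProd R.poly Edge) Edge))) = ⊤) ∧
    -- the prism `P = R × I`, generators for `P * pt`
    (∀ (R : Construction) (S : Set (Aut (CartProd R.poly Edge))), Subgroup.closure S = ⊤ →
      Subgroup.closure ((fun f => Join.congr f (OrderIso.refl Pt)) '' S :
          Set (Aut (Join (CartProd R.poly Edge) Pt))) = ⊤) ∧
    -- the pyramid `P = R * pt`, generators for `P × I`
    (∀ R : Construction,
      SwapsCopies (CartProd.congr (OrderIso.refl (Join R.poly Pt)) edgeFlip) ∧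
      ∀ (τ : Aut (CartProd (Join R.poly Pt) Edge)), SwapsCopies τ →
        ∀ S : Set (Aut (Join R.poly Pt)), Subgroup.closure S = ⊤ →
          Subgroup.closure (insert τ
            ((fun f => CartProd.congr f (OrderIso.refl Edge)) '' S) :
              Set (Aut (CartProd (Join R.poly Pt) Edge))) = ⊤) ∧
    -- the pyramid `P = R * pt`, generators for `P * pt`
    (∀ (R : Construction) (S : Set (Aut (Join R.poly Pt))), Subgroup.closure S = ⊤ →
      Subgroup.closure (insert Join.swapLast
        ((fun f => Join.congr f (OrderIso.refl Pt)) '' S) :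
          Set (Aut (Join (Join R.poly Pt) Pt))) = ⊤) :=
  ⟨Construction.isPolytope, Construction.timesEdge_cases, Construction.joinPt_cases,
    fun _ _ _ hk ⟨e⟩ => nonempty_aut_cube hk e,
    fun _ _ _ _ _ _ hn hk hQ hpyr ⟨e⟩ => nonempty_aut_cartProd_cube hn hk hQ hpyr e,
    fun _ _ _ _ ⟨e⟩ => nonempty_aut_simplex e,
    fun _ _ _ _ _ _ hn _ hQ hpr ⟨e⟩ => nonempty_aut_join_simplex hn hQ hpr e,
    fun w => w.decomposition.nonempty_aut,
    fun w => w.decomposition.rel,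
    fun m => ⟨cubeVertex_injective, range_cubeVertex m, exists_generators_cube m⟩,
    fun m => ⟨JoinPow.simplexVertex_injective, range_simplexVertex (m + 1),
      exists_generators_simplex m⟩,
    Construction.closure_prism_timesEdge,
    Construction.closure_prism_joinPt,
    fun R => ⟨swapsCopies_congr_edgeFlip, R.closure_pyramid_timesEdge⟩,
    Construction.closure_pyramid_joinPt⟩
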